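/- **Theorem 9.** Let $d\ge 1$ and let $0<\beta_{0,t}<\beta_{1,t}<\infty$, $t=0,\dots,d$, be constants. Let $\phi\in(\beta_{0,0},\beta_{1,0})$ and $\theta_t,\tilde\theta_t\in(\beta_{0,t},\beta_{1,t})$, $t=1,\dots,d$; the $\tilde\theta_t$ are fixed, possibly misspecified, values for the $\theta_t$. Let $X(x)$, $x\in[0,1]^d$, be a mean-zero Gaussian random field with covariance function $$\operatorname{Cov}(X(x),X(y))=\frac{\pi^d\phi^d}{2^d\theta_1^3\cdots\theta_d^3}\prod_{t=1}^d(1+\theta_t|x_t-y_t|)e^{-\theta_t|x_t-y_t|}.$$ For $n\ge1$ let $\tilde X_n$ be the $n^d$-vector of the observations $X(i_1/n,\dots,i_d/n)$, $1\le i_t\le n$, in lexicographic order, let $R_{\theta,n}$ be the $n\times n$ matrix with $(i,j)$ entry $(1+\theta|i-j|/n)e^{-\theta|i-j|/n}$, and put $$Q_n=\frac{2^d\tilde\theta_1^3\cdots\tilde\theta_d^3}{\pi^dn^d}\,\tilde X_n'\Big(\bigotimes_{t=1}^dR_{\tilde\theta_t,n}\Big)^{-1}\tilde X_n,\qquad \hat\phi_{\tilde\theta_1,\dots,\tilde\theta_d}=Q_n^{1/d}.$$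 Then $Q_n$ is square integrable and, as $n\to\infty$, $$E[Q_n]=\phi^d+O(n^{-1}),\qquad \operatorname{Var}(Q_n)=O(n^{-d}),$$ uniformly over all $\phi\in(\beta_{0,0},\beta_{1,0})$ and $\theta_t,\tilde\theta_t\in(\beta_{0,t},\beta_{1,t})$, $t=1,\dots,d$ (the implied constants depend only on $d$ and the $\beta$'s). For every $n\ge1$, almost surely, $\hat\phi_{\tilde\theta_1,\dots,\tilde\theta_d}$ is positive and is the unique maximizer over $\psi>0$ of the likelihood $$L_n(\psi,\tilde\theta_1,\dots,\tilde\theta_d)=(2\pi)^{-n^d/2}|\Sigma_\psi|^{-1/2}\exp\big(-\tilde X_n'\Sigma_\psi^{-1}\tilde X_n/2\big),\qquad \Sigma_\psi=\frac{\pi^d\psi^d}{2^d\tilde\theta_1^3\cdots\tilde\theta_d^3}\bigotimes_{t=1}^dR_{\tilde\theta_t,n}.$$ Consequently $\hat\phi_{\tilde\theta_1,\dots,\tilde\theta_d}\to\phi$ in probability as $n\to\infty$. -/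

import Mathlib

open MeasureTheory ProbabilityTheory Filter Topology
open scoped ENNReal

noncomputable section

namespace MaternField

/-- The multiplicative Matérn-type covariance function of smoothness `3/2` on `ℝ^d`, with scale
parameter `φ` and correlation parameters `θ 0, …, θ (d-1)`. -/
def covFun {d : ℕ} (φ : ℝ) (θ : Fin d → ℝ) (x y : Fin d → ℝ) : ℝ :=
  (Real.pi ^ d * φ ^ d) / (2 ^ d * ∏ t, θ t ^ 3) *
    ∏ t, (1 + θ t * |x t - y t|) * Real.exp (-(θ t * |x t - y t|))

/-- `X` is (under `P`) a mean-zero Gaussian random field on the cube `[0,1]^d` with the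
Matérn-type covariance function `covFun φ θ`. -/
structure IsMaternField {d : ℕ} {Ω : Type*} [MeasurableSpace Ω] (φ : ℝ) (θ : Fin d → ℝ)
    (X : Set.Icc (0 : Fin d → ℝ) 1 → Ω → ℝ) (P : Measure Ω) : Prop where
  gaussian : IsGaussianProcess X P
  mean_zero : ∀ x, ∫ ω, X x ω ∂P = 0
  cov_eq : ∀ x y, cov[X x, X y; P] = covFun φ θ x y

/-- The point `(i_1/n, …, i_d/n)` of the regular grid, `1 ≤ i_t ≤ n`; the element `k` of `Fin n`
stands for the integer `k + 1`. -/
def gridPoint {d : ℕ} (n : ℕ) (i : Fin d → Fin n) : Set.Icc (0 : Fin d → ℝ) 1 :=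
  ⟨fun t => (((i t : ℕ) + 1 : ℕ) : ℝ) / n, by
    constructor
    · intro t
      simp only [Pi.zero_apply]
      positivity
    · intro t
      simp only [Pi.one_apply]
      have h : (i t : ℕ) + 1 ≤ n := (i t).isLt
      exact div_le_one_of_le₀ (by exact_mod_cast h) (by positivity)⟩

/-- The vector of the `n^d` observations of the field on the grid. It is indexed by the
multi-indices themselves instead of their ranks in the lexicographic order. -/
def obs {d : ℕ} {Ω : Type*} (X : Set.Icc (0 : Fin d → ℝ) 1 → Ω → ℝ) (n : ℕ) (ω : Ω) :
    (Fin d → Fin n) → ℝ :=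
  fun i => X (gridPoint n i) ω

/-- The `n × n` correlation matrix `R_{θ,n}`, whose `(i, j)` entry is
`(1 + θ |i - j| / n) exp (-θ |i - j| / n)`. -/
def corrMatrix (θ : ℝ) (n : ℕ) : Matrix (Fin n) (Fin n) ℝ :=
  Matrix.of fun i j =>
    (1 + θ * |((i : ℕ) : ℝ) - ((j : ℕ) : ℝ)| / n) *
      Real.exp (-(θ * |((i : ℕ) : ℝ) - ((j : ℕ) : ℝ)| / n))

/-- The Kronecker product of the `n × n` matrices `A 0, …, A (d-1)`, with rows and columns indexed
by multi-indices. -/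
def kronecker {d n : ℕ} (A : Fin d → Matrix (Fin n) (Fin n) ℝ) :
    Matrix (Fin d → Fin n) (Fin d → Fin n) ℝ :=
  Matrix.of fun i j => ∏ t, A t (i t) (j t)

/-- The covariance matrix `Σ_{φ,θ;n}` of the observations. -/
def covMatrix {d : ℕ} (φ : ℝ) (θ : Fin d → ℝ) (n : ℕ) :
    Matrix (Fin d → Fin n) (Fin d → Fin n) ℝ :=
  ((Real.pi ^ d * φ ^ d) / (2 ^ d * ∏ t, θ t ^ 3)) • kronecker fun t => corrMatrix (θ t) n

/-- The likelihood function `L_n(φ, θ)` at the data vector `x`, i.e. the density at `x` of the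
centred normal distribution with covariance matrix `Σ_{φ,θ;n}`. -/
def likelihood {d : ℕ} (n : ℕ) (x : (Fin d → Fin n) → ℝ) (φ : ℝ) (θ : Fin d → ℝ) : ℝ :=
  (2 * Real.pi) ^ (-((n : ℝ) ^ d / 2)) * (covMatrix φ θ n).det ^ (-(1 / 2) : ℝ) *
    Real.exp (-(x ⬝ᵥ ((covMatrix φ θ n)⁻¹.mulVec x)) / 2)

/-- The normalized quadratic form
`(2^d ∏ θ_t^3 / (π^d n^d)) x' (⨂ R_{θ_t,n})⁻¹ x`. -/
def quadForm {d : ℕ} (θ : Fin d → ℝ) (n : ℕ) (x : (Fin d → Fin n) → ℝ) : ℝ :=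
  (2 ^ d * ∏ t, θ t ^ 3) / (Real.pi ^ d * (n : ℝ) ^ d) *
    (x ⬝ᵥ ((kronecker fun t => corrMatrix (θ t) n)⁻¹.mulVec x))

/-- The maximum likelihood-type estimator of the scale parameter when the correlation parameters
are set to `θ`: the `d`-th root of the normalized quadratic form. -/
def phiHat {d : ℕ} (θ : Fin d → ℝ) (n : ℕ) (x : (Fin d → Fin n) → ℝ) : ℝ :=
  quadForm θ n x ^ (1 / (d : ℝ))

end MaternField

end

open MaternField

noncomputable section

namespace MaternField

/-! In one coordinate let K_σ = R_{σ,n} / σ³. A centred Gaussian quadratic form x'Wx with covariance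
S has mean tr(WS) and variance at most a constant times tr((WS)²). Here W and S are Kronecker
products, so both traces factor over the coordinates. It then suffices to show tr(K_τ⁻¹K_θ) = n +
O(1) and tr((K_τ⁻¹K_θ)²) = O(n), uniformly in the scales. Dividing by σ³ is what makes a wrong scale
invisible to leading order.

The key fact is that -dK_σ/dσ is the Gram matrix of a smoother, Matérn-5/2 kernel. It is a
superposition of rank-one matrices vv' with v bounded in the reproducing kernel Hilbert space of
K_σ, that is, (a·v)² ≤ k a'K_σa for all a, and the total of the constants k does not depend on n
(`pairing_kernDerivMatrix_mem`). Pairing with aa' gives 0 ≤ -d/dσ (a'K_σa) ≤ Γ a'K_σa, and a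
Gronwall argument yields K_θ ≤ E K_τ (`quad_kernMatrix_le`). Pairing with K_τ⁻¹ then shows that
tr(K_τ⁻¹K_σ) has bounded derivative in σ; it equals n at σ = τ
(`abs_trace_inv_mul_kernMatrix_sub_card_le`). The second trace is at most E times the first
(`trace_mul_self_le`).

The maximum property is log t < t - 1 for t ≠ 1, applied to t = Q_n/ψ^d (`likelihood_lt`), and
consistency is Chebyshev's inequality followed by the continuous map y ↦ y^(1/d). -/

/-! ### Matérn kernels and their rank-one decompositions. -/

/-- The Matérn-`3/2` kernel, normalized so that its spectral density is asymptotically independent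
of the scale `σ`. -/
def kern (σ h : ℝ) : ℝ := (1 + σ * |h|) * Real.exp (-(σ * |h|)) / σ ^ 3

/-- The negative of the derivative of `kern` in the scale; it is a Matérn-`5/2` kernel. -/
def kernDeriv (σ h : ℝ) : ℝ :=
  Real.exp (-(σ * |h|)) * (3 / σ ^ 4 + 3 * |h| / σ ^ 3 + |h| ^ 2 / σ ^ 2)

/-- The causal fundamental solution of `(D + σ)²`. -/
def green (σ u : ℝ) : ℝ := max u 0 * Real.exp (-(σ * u))

/-- Half of this function is the causal fundamental solution of `(D + σ)³`. -/
def greenSq (σ u : ℝ) : ℝ := max u 0 ^ 2 * Real.exp (-(σ * u))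

lemma continuous_green (σ : ℝ) : Continuous (green σ) := by unfold green; fun_prop

lemma continuous_greenSq (σ : ℝ) : Continuous (greenSq σ) := by unfold greenSq; fun_prop

lemma hasDerivAt_kern {σ : ℝ} (hσ : 0 < σ) (h : ℝ) :
    HasDerivAt (fun σ => kern σ h) (-kernDeriv σ h) σ := by
  unfold kern kernDeriv
  have h1 : HasDerivAt (fun σ : ℝ => 1 + σ * |h|) (|h|) σ := by
    simpa using ((hasDerivAt_id σ).mul_const |h|).const_add 1
  have h2 : HasDerivAt (fun σ : ℝ => Real.exp (-(σ * |h|)))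
      (Real.exp (-(σ * |h|)) * (-|h|)) σ := by
    simpa using ((hasDerivAt_id σ).mul_const |h|).neg.exp
  have h3 := (h1.mul h2).div (hasDerivAt_pow 3 σ) (by positivity)
  refine h3.congr_deriv ?_
  simp only [Pi.mul_apply]
  field_simp
  ring

/-- The integrand vanishes for s ≥ x; on [0, x] it is a polynomial times an exponential, with an
explicit antiderivative. Its value at s = x gives the stationary term, its value at s = 0 the
boundary term. -/
lemma integral_green_mul_green {σ x y : ℝ} (hσ : 0 < σ) (hx : 0 ≤ x) (hxy : x ≤ y) (hx1 : x ≤ 1) :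
    ∫ s in (0 : ℝ)..1, green σ (x - s) * green σ (y - s) =
      Real.exp (-(σ * (y - x))) * ((y - x) / (4 * σ ^ 2) + 1 / (4 * σ ^ 3)) -
      Real.exp (-(σ * (x + y))) * (x * y / (2 * σ) + (x + y) / (4 * σ ^ 2) + 1 / (4 * σ ^ 3)) := by
  have hint : ∀ a b, IntervalIntegrable (fun s => green σ (x - s) * green σ (y - s)) volume a b := by
    intro a b
    apply Continuous.intervalIntegrable
    exact ((continuous_green σ).comp (by fun_prop)).mul ((continuous_green σ).comp (by fun_prop))
  rw [← intervalIntegral.integral_add_adjacent_intervals (hint 0 x) (hint x 1)]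
  have e2 : ∫ s in x..1, green σ (x - s) * green σ (y - s) = 0 := by
    rw [intervalIntegral.integral_congr (g := fun _ => 0)]
    · simp
    · intro s hs
      rw [Set.uIcc_of_le hx1] at hs
      simp [green, max_eq_right (sub_nonpos.2 hs.1)]
  have e1 : ∫ s in (0 : ℝ)..x, green σ (x - s) * green σ (y - s) =
      ∫ s in (0 : ℝ)..x, (x - s) * (y - s) * Real.exp (-(σ * (x + y - 2 * s))) := by
    apply intervalIntegral.integral_congr
    intro s hs
    rw [Set.uIcc_of_le hx] at hs
    simp only [green]
    rw [max_eq_left (sub_nonneg.2 hs.2), max_eq_left (sub_nonneg.2 (hs.2.trans hxy)),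
      show -(σ * (x + y - 2 * s)) = -(σ * (x - s)) + -(σ * (y - s)) by ring, Real.exp_add]
    ring
  rw [e1, e2, intervalIntegral.integral_eq_sub_of_hasDerivAt
    (f := fun s => Real.exp (-(σ * (x + y - 2 * s))) *
      ((x - s) * (y - s) / (2 * σ) + (x + y - 2 * s) / (4 * σ ^ 2) + 1 / (4 * σ ^ 3)))]
  · rw [show x + y - 2 * x = y - x by ring]
    simp
  · intro s _
    have h1 : HasDerivAt (fun s : ℝ => -(σ * (x + y - 2 * s))) (2 * σ) s := by
      have := (((hasDerivAt_id s).const_mul 2).const_sub (x + y)).const_mul (-σ)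
      exact (this.congr_deriv (by ring)).congr_of_eventuallyEq (.of_forall fun s => by simp)
    have h2 : HasDerivAt (fun s : ℝ => x - s) (-1) s := (hasDerivAt_id s).const_sub x
    have h3 : HasDerivAt (fun s : ℝ => y - s) (-1) s := (hasDerivAt_id s).const_sub y
    have h4 : HasDerivAt (fun s : ℝ => x + y - 2 * s) (-2) s := by
      simpa using ((hasDerivAt_id s).const_mul 2).const_sub (x + y)
    have h5 := h1.exp.mul ((((h2.mul h3).div_const (2 * σ)).add
      (h4.div_const (4 * σ ^ 2))).add_const (1 / (4 * σ ^ 3)))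
    refine h5.congr_deriv ?_
    simp only [Pi.add_apply, Pi.mul_apply]
    field_simp
    ring
  · exact Continuous.intervalIntegrable (by fun_prop) _ _

lemma integral_greenSq_mul_greenSq {σ x y : ℝ} (hσ : 0 < σ) (hx : 0 ≤ x) (hxy : x ≤ y)
    (hx1 : x ≤ 1) :
    ∫ s in (0 : ℝ)..1, greenSq σ (x - s) * greenSq σ (y - s) =
      Real.exp (-(σ * (y - x))) *
        ((y - x) ^ 2 / (4 * σ ^ 3) + 3 * (y - x) / (4 * σ ^ 4) + 3 / (4 * σ ^ 5)) -
      Real.exp (-(σ * (x + y))) * ((x * y) ^ 2 / (2 * σ) + x * y * (x + y) / (2 * σ ^ 2) +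
        (x ^ 2 + 4 * x * y + y ^ 2) / (4 * σ ^ 3) + 3 * (x + y) / (4 * σ ^ 4) +
        3 / (4 * σ ^ 5)) := by
  have hint : ∀ a b,
      IntervalIntegrable (fun s => greenSq σ (x - s) * greenSq σ (y - s)) volume a b := by
    intro a b
    apply Continuous.intervalIntegrable
    exact ((continuous_greenSq σ).comp (by fun_prop)).mul
      ((continuous_greenSq σ).comp (by fun_prop))
  rw [← intervalIntegral.integral_add_adjacent_intervals (hint 0 x) (hint x 1)]
  have e2 : ∫ s in x..1, greenSq σ (x - s) * greenSq σ (y - s) = 0 := by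
    rw [intervalIntegral.integral_congr (g := fun _ => 0)]
    · simp
    · intro s hs
      rw [Set.uIcc_of_le hx1] at hs
      simp [greenSq, max_eq_right (sub_nonpos.2 hs.1)]
  have e1 : ∫ s in (0 : ℝ)..x, greenSq σ (x - s) * greenSq σ (y - s) =
      ∫ s in (0 : ℝ)..x, ((x - s) * (y - s)) ^ 2 * Real.exp (-(σ * (x + y - 2 * s))) := by
    apply intervalIntegral.integral_congr
    intro s hs
    rw [Set.uIcc_of_le hx] at hs
    simp only [greenSq]
    rw [max_eq_left (sub_nonneg.2 hs.2), max_eq_left (sub_nonneg.2 (hs.2.trans hxy)),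
      show -(σ * (x + y - 2 * s)) = -(σ * (x - s)) + -(σ * (y - s)) by ring, Real.exp_add]
    ring
  rw [e1, e2, intervalIntegral.integral_eq_sub_of_hasDerivAt
    (f := fun s => Real.exp (-(σ * (x + y - 2 * s))) *
      (((x - s) * (y - s)) ^ 2 / (2 * σ) + (x - s) * (y - s) * (x + y - 2 * s) / (2 * σ ^ 2) +
        ((x + y - 2 * s) ^ 2 + 2 * ((x - s) * (y - s))) / (4 * σ ^ 3) +
        3 * (x + y - 2 * s) / (4 * σ ^ 4) + 3 / (4 * σ ^ 5)))]
  · rw [show x + y - 2 * x = y - x by ring]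
    simp only [sub_self, mul_zero, sub_zero]
    ring
  · intro s _
    have h1 : HasDerivAt (fun s : ℝ => -(σ * (x + y - 2 * s))) (2 * σ) s := by
      have := (((hasDerivAt_id s).const_mul 2).const_sub (x + y)).const_mul (-σ)
      exact (this.congr_deriv (by ring)).congr_of_eventuallyEq (.of_forall fun s => by simp)
    have h2 : HasDerivAt (fun s : ℝ => x - s) (-1) s := (hasDerivAt_id s).const_sub x
    have h3 : HasDerivAt (fun s : ℝ => y - s) (-1) s := (hasDerivAt_id s).const_sub y
    have h4 : HasDerivAt (fun s : ℝ => x + y - 2 * s) (-2) s := by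
      simpa using ((hasDerivAt_id s).const_mul 2).const_sub (x + y)
    have h23 := h2.mul h3
    have h5 := h1.exp.mul ((((((h23.pow 2).div_const (2 * σ)).add
      ((h23.mul h4).div_const (2 * σ ^ 2))).add
      (((h4.pow 2).add (h23.const_mul 2)).div_const (4 * σ ^ 3))).add
      ((h4.const_mul 3).div_const (4 * σ ^ 4))).add_const (3 / (4 * σ ^ 5)))
    refine h5.congr_deriv ?_
    simp only [Pi.add_apply, Pi.mul_apply, Pi.pow_apply]
    field_simp
    ring
  · exact Continuous.intervalIntegrable (by fun_prop) _ _

/-- The Matérn-`3/2` kernel on `[0,1]` as a superposition of rank-one kernels. -/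
lemma kern_eq {σ x y : ℝ} (hσ : 0 < σ) (hx : x ∈ Set.Icc (0 : ℝ) 1) (hy : y ∈ Set.Icc (0 : ℝ) 1) :
    kern σ (x - y) = 4 * (∫ s in (0 : ℝ)..1, green σ (x - s) * green σ (y - s)) +
      1 / σ * (x * Real.exp (-(σ * x)) * (y * Real.exp (-(σ * y)))) +
      1 / σ * ((x + 1 / σ) * Real.exp (-(σ * x)) * ((y + 1 / σ) * Real.exp (-(σ * y)))) := by
  -- The stationary solution of (D + σ)² Y = 2·(white noise) has covariance `kern σ`. The integral
  -- is the noise on [0, 1]; the two rank-one terms come from the initial state at 0.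
  wlog hxy : x ≤ y generalizing x y
  · have := this hy hx (le_of_not_ge hxy)
    rw [kern, abs_sub_comm, ← kern, this]
    simp only [mul_comm (green σ (x - _))]
    ring
  rw [integral_green_mul_green hσ hx.1 hxy hx.2, kern, abs_sub_comm, abs_of_nonneg (by linarith),
    show -(σ * (x + y)) = -(σ * x) + -(σ * y) by ring, Real.exp_add]
  field_simp
  ring

/-- The Matérn-`5/2` kernel on `[0,1]` as a superposition of rank-one kernels. -/
lemma kernDeriv_eq {σ x y : ℝ} (hσ : 0 < σ) (hx : x ∈ Set.Icc (0 : ℝ) 1)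
    (hy : y ∈ Set.Icc (0 : ℝ) 1) :
    kernDeriv σ (x - y) = 4 * σ * (∫ s in (0 : ℝ)..1, greenSq σ (x - s) * greenSq σ (y - s)) +
      2 * ((x ^ 2 + x / σ + 1 / (2 * σ ^ 2)) * Real.exp (-(σ * x)) *
        ((y ^ 2 + y / σ + 1 / (2 * σ ^ 2)) * Real.exp (-(σ * y)))) +
      2 * ((x / σ + 1 / σ ^ 2) * Real.exp (-(σ * x)) *
        ((y / σ + 1 / σ ^ 2) * Real.exp (-(σ * y)))) +
      1 / 2 * (1 / σ ^ 2 * Real.exp (-(σ * x)) * (1 / σ ^ 2 * Real.exp (-(σ * y)))) := by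
  wlog hxy : x ≤ y generalizing x y
  · have := this hy hx (le_of_not_ge hxy)
    rw [kernDeriv, abs_sub_comm, ← kernDeriv, this]
    simp only [mul_comm (greenSq σ (x - _))]
    ring
  rw [integral_greenSq_mul_greenSq hσ hx.1 hxy hx.2, kernDeriv, abs_sub_comm,
    abs_of_nonneg (by linarith),
    show -(σ * (x + y)) = -(σ * x) + -(σ * y) by ring, Real.exp_add]
  field_simp
  ring

/-- The fundamental solution of (D + σ)³ is that of (D + σ)² convolved with that of D + σ. This
carries bounds on `green` over to `greenSq`. -/
lemma greenSq_eq_integral {σ x s : ℝ} (hx1 : x ≤ 1) (hs1 : s ≤ 1) :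
    greenSq σ (x - s) = 2 * ∫ r in s..1, green σ (x - r) * Real.exp (-(σ * (r - s))) := by
  have hint : ∀ a b,
      IntervalIntegrable (fun r => green σ (x - r) * Real.exp (-(σ * (r - s)))) volume a b := by
    intro a b
    apply Continuous.intervalIntegrable
    exact ((continuous_green σ).comp (by fun_prop)).mul (by fun_prop)
  rcases le_total x s with h | h
  · rw [intervalIntegral.integral_congr (g := fun _ => 0)]
    · simp [greenSq, max_eq_right (sub_nonpos.2 h)]
    · intro r hr
      rw [Set.uIcc_of_le hs1] at hr
      simp [green, max_eq_right (sub_nonpos.2 (h.trans hr.1))]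
  rw [← intervalIntegral.integral_add_adjacent_intervals (hint s x) (hint x 1)]
  have e2 : ∫ r in x..1, green σ (x - r) * Real.exp (-(σ * (r - s))) = 0 := by
    rw [intervalIntegral.integral_congr (g := fun _ => 0)]
    · simp
    · intro r hr
      rw [Set.uIcc_of_le hx1] at hr
      simp [green, max_eq_right (sub_nonpos.2 hr.1)]
  have e1 : ∫ r in s..x, green σ (x - r) * Real.exp (-(σ * (r - s))) =
      ∫ r in s..x, (x - r) * Real.exp (-(σ * (x - s))) := by
    apply intervalIntegral.integral_congr
    intro r hr
    rw [Set.uIcc_of_le h] at hr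
    simp only [green]
    rw [max_eq_left (sub_nonneg.2 hr.2), mul_assoc, ← Real.exp_add]
    ring_nf
  rw [e1, e2, intervalIntegral.integral_mul_const, intervalIntegral.integral_comp_sub_left
    (fun r => r), integral_id, greenSq, max_eq_left (sub_nonneg.2 h)]
  ring

/-! ### Gram matrices and their dependence on the scale. -/

section Gram

variable {ι : Type*} [Fintype ι]

/-- The quadratic form `v' W v`. -/
def quad (W : Matrix ι ι ℝ) (v : ι → ℝ) : ℝ := ∑ i, ∑ j, W i j * (v i * v j)

/-- The Frobenius pairing of two matrices. -/
def pairing (W M : Matrix ι ι ℝ) : ℝ := ∑ i, ∑ j, W i j * M i j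

/-- The Gram matrix of the kernel `kern σ` at the points `x i`. -/
def kernMatrix (σ : ℝ) (x : ι → ℝ) : Matrix ι ι ℝ := Matrix.of fun i j => kern σ (x i - x j)

/-- The Gram matrix of the kernel `kernDeriv σ` at the points `x i`. -/
def kernDerivMatrix (σ : ℝ) (x : ι → ℝ) : Matrix ι ι ℝ :=
  Matrix.of fun i j => kernDeriv σ (x i - x j)

lemma quad_eq_dotProduct (W : Matrix ι ι ℝ) (v : ι → ℝ) : quad W v = v ⬝ᵥ W.mulVec v := by
  simp only [quad, dotProduct, Matrix.mulVec, Finset.mul_sum]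
  exact Finset.sum_congr rfl fun i _ => Finset.sum_congr rfl fun j _ => by ring

lemma quad_vecMulVec (a v : ι → ℝ) : quad (Matrix.vecMulVec a a) v = (a ⬝ᵥ v) ^ 2 := by
  simp only [quad, Matrix.vecMulVec_apply, dotProduct, sq, Finset.sum_mul_sum]
  exact Finset.sum_congr rfl fun i _ => Finset.sum_congr rfl fun j _ => by ring

lemma pairing_vecMulVec (a : ι → ℝ) (M : Matrix ι ι ℝ) :
    pairing (Matrix.vecMulVec a a) M = quad M a := by
  simp only [quad, pairing, Matrix.vecMulVec_apply]
  exact Finset.sum_congr rfl fun i _ => Finset.sum_congr rfl fun j _ => by ring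

lemma pairing_integral (W : Matrix ι ι ℝ) (f : ι → ℝ → ℝ) (hf : ∀ i, Continuous (f i)) (a b : ℝ) :
    ∑ i, ∑ j, W i j * ∫ s in a..b, f i s * f j s = ∫ s in a..b, quad W (fun i => f i s) := by
  simp only [quad]
  rw [intervalIntegral.integral_finsetSum]
  · refine Finset.sum_congr rfl fun i _ => ?_
    rw [intervalIntegral.integral_finsetSum]
    · simp
    · exact fun j _ => (continuous_const.mul ((hf i).mul (hf j))).intervalIntegrable _ _
  · refine fun i _ => Continuous.intervalIntegrable ?_ _ _
    exact continuous_finsetSum _ fun j _ => continuous_const.mul ((hf i).mul (hf j))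

lemma continuous_quad (W : Matrix ι ι ℝ) {f : ι → ℝ → ℝ} (hf : ∀ i, Continuous (f i)) :
    Continuous fun s => quad W (fun i => f i s) :=
  continuous_finsetSum _ fun i _ => continuous_finsetSum _ fun j _ =>
    continuous_const.mul ((hf i).mul (hf j))

variable {σ : ℝ} {x : ι → ℝ}

lemma pairing_kernMatrix (hσ : 0 < σ) (hx : ∀ i, x i ∈ Set.Icc (0 : ℝ) 1) (W : Matrix ι ι ℝ) :
    pairing W (kernMatrix σ x) = 4 * (∫ s in (0 : ℝ)..1, quad W fun i => green σ (x i - s)) +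
      1 / σ * quad W (fun i => x i * Real.exp (-(σ * x i))) +
      1 / σ * quad W (fun i => (x i + 1 / σ) * Real.exp (-(σ * x i))) := by
  rw [← pairing_integral W (fun i s => green σ (x i - s))
    (fun i => (continuous_green σ).comp (by fun_prop))]
  simp only [pairing, quad, Finset.mul_sum, ← Finset.sum_add_distrib]
  refine Finset.sum_congr rfl fun i _ => Finset.sum_congr rfl fun j _ => ?_
  rw [kernMatrix, Matrix.of_apply, kern_eq hσ (hx i) (hx j)]
  ring

lemma pairing_kernDerivMatrix (hσ : 0 < σ) (hx : ∀ i, x i ∈ Set.Icc (0 : ℝ) 1)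
    (W : Matrix ι ι ℝ) :
    pairing W (kernDerivMatrix σ x) =
      4 * σ * (∫ s in (0 : ℝ)..1, quad W fun i => greenSq σ (x i - s)) +
      2 * quad W (fun i => (x i ^ 2 + x i / σ + 1 / (2 * σ ^ 2)) * Real.exp (-(σ * x i))) +
      2 * quad W (fun i => (x i / σ + 1 / σ ^ 2) * Real.exp (-(σ * x i))) +
      1 / 2 * quad W (fun i => 1 / σ ^ 2 * Real.exp (-(σ * x i))) := by
  rw [← pairing_integral W (fun i s => greenSq σ (x i - s))
    (fun i => (continuous_greenSq σ).comp (by fun_prop))]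
  simp only [pairing, quad, Finset.mul_sum, ← Finset.sum_add_distrib]
  refine Finset.sum_congr rfl fun i _ => Finset.sum_congr rfl fun j _ => ?_
  rw [kernDerivMatrix, Matrix.of_apply, kernDeriv_eq hσ (hx i) (hx j)]
  ring

lemma quad_kernMatrix (hσ : 0 < σ) (hx : ∀ i, x i ∈ Set.Icc (0 : ℝ) 1) (a : ι → ℝ) :
    quad (kernMatrix σ x) a = 4 * (∫ s in (0 : ℝ)..1, (a ⬝ᵥ fun i => green σ (x i - s)) ^ 2) +
      1 / σ * (a ⬝ᵥ fun i => x i * Real.exp (-(σ * x i))) ^ 2 +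
      1 / σ * (a ⬝ᵥ fun i => (x i + 1 / σ) * Real.exp (-(σ * x i))) ^ 2 := by
  rw [← pairing_vecMulVec, pairing_kernMatrix hσ hx]
  simp only [quad_vecMulVec]

lemma integral_sq_green_nonneg (a : ι → ℝ) :
    0 ≤ ∫ s in (0 : ℝ)..1, (a ⬝ᵥ fun i => green σ (x i - s)) ^ 2 :=
  intervalIntegral.integral_nonneg zero_le_one fun _ _ => sq_nonneg _

lemma quad_kernMatrix_nonneg (hσ : 0 < σ) (hx : ∀ i, x i ∈ Set.Icc (0 : ℝ) 1) (a : ι → ℝ) :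
    0 ≤ quad (kernMatrix σ x) a := by
  rw [quad_kernMatrix hσ hx]
  have := integral_sq_green_nonneg (σ := σ) (x := x) a
  positivity

/-- Each rank-one term of K_σ is dominated by K_σ, since the remaining terms are nonnegative. The
two functions therefore have squared reproducing-kernel norm at most σ. -/
lemma sq_dotProduct_le_of_linear (hσ : 0 < σ) (hx : ∀ i, x i ∈ Set.Icc (0 : ℝ) 1) (a : ι → ℝ) :
    (a ⬝ᵥ fun i => x i * Real.exp (-(σ * x i))) ^ 2 +
      (a ⬝ᵥ fun i => (x i + 1 / σ) * Real.exp (-(σ * x i))) ^ 2 ≤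
      σ * quad (kernMatrix σ x) a := by
  rw [quad_kernMatrix hσ hx]
  have := integral_sq_green_nonneg (σ := σ) (x := x) a
  have h : 0 ≤ σ * (4 * ∫ s in (0 : ℝ)..1, (a ⬝ᵥ fun i => green σ (x i - s)) ^ 2) := by positivity
  rw [mul_add, mul_add, ← mul_assoc σ (1 / σ), ← mul_assoc σ (1 / σ), mul_one_div_cancel hσ.ne']
  linarith

lemma sq_integral_le {f : ℝ → ℝ} (hf : Continuous f) {s : ℝ} (h0 : 0 ≤ s) (h1 : s ≤ 1) :
    (∫ r in s..1, f r) ^ 2 ≤ ∫ r in s..1, f r ^ 2 := by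
  set c := ∫ r in s..1, f r with hc
  have h : 0 ≤ ∫ r in s..1, (f r - c) ^ 2 :=
    intervalIntegral.integral_nonneg h1 fun _ _ => sq_nonneg _
  have e : ∫ r in s..1, (f r - c) ^ 2 = (∫ r in s..1, f r ^ 2) - 2 * c * c + c ^ 2 * (1 - s) := by
    have : ∀ r, (f r - c) ^ 2 = f r ^ 2 - 2 * c * f r + c ^ 2 := fun r => by ring
    simp only [this]
    rw [intervalIntegral.integral_add, intervalIntegral.integral_sub,
      intervalIntegral.integral_const_mul, ← hc, intervalIntegral.integral_const]
    · simp [mul_comm]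
    all_goals exact Continuous.intervalIntegrable (by fun_prop) _ _
  -- The expanded square says (1 + s)c² ≤ ∫ f², and s ≥ 0.
  nlinarith [sq_nonneg c]

/-- By `greenSq_eq_integral` the left side is the square of 2∫ A(r)e^{-σ(r-s)} dr with A(r) = Σ aᵢ
green(xᵢ - r). Cauchy–Schwarz bounds it by 4∫A², which is the integral part of a'K_σa. -/
lemma sq_dotProduct_greenSq_le (hσ : 0 < σ) (hx : ∀ i, x i ∈ Set.Icc (0 : ℝ) 1) {s : ℝ}
    (hs : s ∈ Set.Icc (0 : ℝ) 1) (a : ι → ℝ) :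
    (a ⬝ᵥ fun i => greenSq σ (x i - s)) ^ 2 ≤ quad (kernMatrix σ x) a := by
  set A : ℝ → ℝ := fun r => a ⬝ᵥ fun i => green σ (x i - r) with hA
  have hAc : Continuous A := by
    refine continuous_finsetSum _ fun i _ => continuous_const.mul ?_
    exact (continuous_green σ).comp (by fun_prop)
  have e : (a ⬝ᵥ fun i => greenSq σ (x i - s)) =
      2 * ∫ r in s..1, A r * Real.exp (-(σ * (r - s))) := by
    simp only [hA, dotProduct, Finset.sum_mul]
    rw [intervalIntegral.integral_finsetSum, Finset.mul_sum]
    · refine Finset.sum_congr rfl fun i _ => ?_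
      rw [greenSq_eq_integral (hx i).2 hs.2, mul_left_comm, ← intervalIntegral.integral_const_mul]
      simp only [mul_assoc]
    · intro i _
      refine Continuous.intervalIntegrable (.mul (continuous_const.mul ?_) (by fun_prop)) _ _
      exact (continuous_green σ).comp (by fun_prop)
  have h1 := sq_integral_le (f := fun r => A r * Real.exp (-(σ * (r - s)))) (by fun_prop) hs.1 hs.2
  have h2 : ∫ r in s..1, (A r * Real.exp (-(σ * (r - s)))) ^ 2 ≤ ∫ r in s..1, A r ^ 2 := by
    refine intervalIntegral.integral_mono_on hs.2
      (Continuous.intervalIntegrable (by fun_prop) _ _)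
      (Continuous.intervalIntegrable (by fun_prop) _ _) fun r hr => ?_
    rw [mul_pow]
    refine mul_le_of_le_one_right (sq_nonneg _) (pow_le_one₀ (Real.exp_nonneg _) ?_)
    exact Real.exp_le_one_iff.2 (neg_nonpos.2 (mul_nonneg hσ.le (sub_nonneg.2 hr.1)))
  have h3 : ∫ r in s..1, A r ^ 2 ≤ ∫ r in (0 : ℝ)..1, A r ^ 2 := by
    have hi : ∀ a b, IntervalIntegrable (fun r => A r ^ 2) volume a b := fun a b =>
      Continuous.intervalIntegrable (by fun_prop) _ _
    rw [← intervalIntegral.integral_add_adjacent_intervals (hi 0 s) (hi s 1)]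
    linarith [intervalIntegral.integral_nonneg (μ := volume) (f := fun r => A r ^ 2) hs.1
      fun _ _ => sq_nonneg _]
  rw [quad_kernMatrix hσ hx, e, mul_pow]
  have h4 : 0 ≤ 1 / σ * (a ⬝ᵥ fun i => x i * Real.exp (-(σ * x i))) ^ 2 := by positivity
  have h5 : 0 ≤ 1 / σ * (a ⬝ᵥ fun i => (x i + 1 / σ) * Real.exp (-(σ * x i))) ^ 2 := by positivity
  linarith

lemma dotProduct_mul_left (a : ι → ℝ) (c : ℝ) (f : ι → ℝ) :
    (a ⬝ᵥ fun i => c * f i) = c * (a ⬝ᵥ f) :=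
  dotProduct_smul c a f

lemma dotProduct_fun_add (a f g : ι → ℝ) :
    (a ⬝ᵥ fun i => f i + g i) = (a ⬝ᵥ f) + (a ⬝ᵥ g) :=
  dotProduct_add a f g

/-- The derivative of the Gram matrices in the scale is controlled by the Gram matrix itself. -/
lemma pairing_kernDerivMatrix_mem (hσ : 0 < σ) (hx : ∀ i, x i ∈ Set.Icc (0 : ℝ) 1)
    {W : Matrix ι ι ℝ} (hW : ∀ v, 0 ≤ quad W v) {c : ℝ}
    (hc : ∀ v k, 0 ≤ k → (∀ a, (a ⬝ᵥ v) ^ 2 ≤ k * quad (kernMatrix σ x) a) → quad W v ≤ k * c) :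
    pairing W (kernDerivMatrix σ x) ∈ Set.Icc 0 ((4 * σ + 4 + 5 / σ) * c) := by
  -- The hypothesis `hc` bounds W on every vector of controlled reproducing-kernel norm, so it is
  -- applied to each rank-one term. Leaving c abstract covers both W = aa' and W = K_τ⁻¹.
  rw [pairing_kernDerivMatrix hσ hx]
  have hcont : Continuous fun s => quad W fun i => greenSq σ (x i - s) :=
    continuous_quad W (f := fun i s => greenSq σ (x i - s))
      fun i => (continuous_greenSq σ).comp (by fun_prop)
  have hI0 : 0 ≤ ∫ s in (0 : ℝ)..1, quad W fun i => greenSq σ (x i - s) :=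
    intervalIntegral.integral_nonneg zero_le_one fun _ _ => hW _
  have hI1 : ∫ s in (0 : ℝ)..1, quad W (fun i => greenSq σ (x i - s)) ≤ c := by
    have := intervalIntegral.integral_mono_on (μ := volume) zero_le_one
      (hcont.intervalIntegrable 0 1) (continuous_const (y := c) |>.intervalIntegrable 0 1)
      fun s hs => by
        simpa using hc (fun i => greenSq σ (x i - s)) 1 zero_le_one fun a => by
          simpa using sq_dotProduct_greenSq_le hσ hx hs a
    simpa using this
  have hlin := sq_dotProduct_le_of_linear hσ hx
  have hK := quad_kernMatrix_nonneg hσ hx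
  have h2 : quad W (fun i => (x i / σ + 1 / σ ^ 2) * Real.exp (-(σ * x i))) ≤ 1 / σ * c := by
    refine hc _ _ (by positivity) fun a => ?_
    have e : (fun i => (x i / σ + 1 / σ ^ 2) * Real.exp (-(σ * x i))) =
        fun i => 1 / σ * ((x i + 1 / σ) * Real.exp (-(σ * x i))) := by
      ext i; field_simp
    rw [e, dotProduct_mul_left, mul_pow]
    calc (1 / σ) ^ 2 * (a ⬝ᵥ fun i => (x i + 1 / σ) * Real.exp (-(σ * x i))) ^ 2
        ≤ (1 / σ) ^ 2 * (σ * quad (kernMatrix σ x) a) := by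
          gcongr
          nlinarith [hlin a, sq_nonneg (a ⬝ᵥ fun i => x i * Real.exp (-(σ * x i)))]
      _ = _ := by field_simp
  -- The exponential is the difference of the two boundary functions times 1/σ, so (q - p)² ≤ 2(p² +
  -- q²) applies.
  have h3 : quad W (fun i => 1 / σ ^ 2 * Real.exp (-(σ * x i))) ≤ 2 / σ * c := by
    refine hc _ _ (by positivity) fun a => ?_
    have e : (fun i => 1 / σ ^ 2 * Real.exp (-(σ * x i))) =
        fun i => 1 / σ * ((x i + 1 / σ) * Real.exp (-(σ * x i)) +
          (-1) * (x i * Real.exp (-(σ * x i)))) := by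
      ext i; field_simp; ring
    rw [e, dotProduct_mul_left, dotProduct_fun_add, dotProduct_mul_left, mul_pow]
    set p := a ⬝ᵥ fun i => x i * Real.exp (-(σ * x i))
    set q := a ⬝ᵥ fun i => (x i + 1 / σ) * Real.exp (-(σ * x i))
    have := hlin a
    calc (1 / σ) ^ 2 * (q + -1 * p) ^ 2
        ≤ (1 / σ) ^ 2 * (2 * (σ * quad (kernMatrix σ x) a)) := by
          gcongr
          nlinarith [sq_nonneg (p + q)]
      _ = _ := by field_simp
  -- The quadratic part is `greenSq` with pole s = 0; the rest is 1/(2σ) times the sum of the two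
  -- boundary functions.
  have h1 : quad W (fun i => (x i ^ 2 + x i / σ + 1 / (2 * σ ^ 2)) * Real.exp (-(σ * x i))) ≤
      (2 + 1 / σ) * c := by
    refine hc _ _ (by positivity) fun a => ?_
    have e : (fun i => (x i ^ 2 + x i / σ + 1 / (2 * σ ^ 2)) * Real.exp (-(σ * x i))) =
        fun i => greenSq σ (x i - 0) + 1 / (2 * σ) * (x i * Real.exp (-(σ * x i)) +
          (x i + 1 / σ) * Real.exp (-(σ * x i))) := by
      ext i
      rw [greenSq, sub_zero, max_eq_left (hx i).1]
      field_simp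
      ring
    rw [e, dotProduct_fun_add, dotProduct_mul_left, dotProduct_fun_add]
    have hg := sq_dotProduct_greenSq_le hσ hx (s := 0) ⟨le_rfl, zero_le_one⟩ a
    set r := a ⬝ᵥ fun i => greenSq σ (x i - 0)
    set p := a ⬝ᵥ fun i => x i * Real.exp (-(σ * x i))
    set q := a ⬝ᵥ fun i => (x i + 1 / σ) * Real.exp (-(σ * x i))
    have := hlin a
    calc (r + 1 / (2 * σ) * (p + q)) ^ 2
        ≤ 2 * r ^ 2 + 2 * (1 / (2 * σ) * (p + q)) ^ 2 := by
          nlinarith [sq_nonneg (r - 1 / (2 * σ) * (p + q))]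
      _ = 2 * r ^ 2 + 2 * ((1 / (2 * σ)) ^ 2 * (p + q) ^ 2) := by ring
      _ ≤ 2 * quad (kernMatrix σ x) a +
          2 * ((1 / (2 * σ)) ^ 2 * (2 * (σ * quad (kernMatrix σ x) a))) := by
          gcongr
          nlinarith [sq_nonneg (p - q)]
      _ = _ := by field_simp
  constructor
  · have := hW (fun i => (x i ^ 2 + x i / σ + 1 / (2 * σ ^ 2)) * Real.exp (-(σ * x i)))
    have := hW (fun i => (x i / σ + 1 / σ ^ 2) * Real.exp (-(σ * x i)))
    have := hW (fun i => 1 / σ ^ 2 * Real.exp (-(σ * x i)))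
    positivity
  · have h4 : 4 * σ * (∫ s in (0 : ℝ)..1, quad W fun i => greenSq σ (x i - s)) ≤ 4 * σ * c := by
      gcongr
    calc _ ≤ 4 * σ * c + 2 * ((2 + 1 / σ) * c) + 2 * (1 / σ * c) + 1 / 2 * (2 / σ * c) := by
          gcongr
      _ = _ := by ring

lemma hasDerivAt_pairing_kernMatrix (hσ : 0 < σ) (W : Matrix ι ι ℝ) (x : ι → ℝ) :
    HasDerivAt (fun σ => pairing W (kernMatrix σ x)) (-pairing W (kernDerivMatrix σ x)) σ := by
  simp only [pairing, ← Finset.sum_neg_distrib, ← mul_neg]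
  exact HasDerivAt.fun_sum fun i _ => HasDerivAt.fun_sum fun j _ =>
    (hasDerivAt_kern hσ _).const_mul _

/-- A bound for the derivative in the scale that holds for all scales in `[b₀, b₁]`. -/
def derivBound (b₀ b₁ : ℝ) : ℝ := 4 * b₁ + 4 + 5 / b₀

lemma le_derivBound {b₀ b₁ : ℝ} (h0 : 0 < b₀) (hσ : σ ∈ Set.Icc b₀ b₁) :
    4 * σ + 4 + 5 / σ ≤ derivBound b₀ b₁ := by
  have := hσ.1
  have := hσ.2
  unfold derivBound
  gcongr

lemma derivBound_nonneg {b₀ b₁ : ℝ} (h0 : 0 < b₀) (h : b₀ ≤ b₁) : 0 ≤ derivBound b₀ b₁ := by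
  have : 0 < b₁ := h0.trans_le h
  unfold derivBound
  positivity

/-- Gram matrices at different scales are comparable. -/
lemma quad_kernMatrix_le {b₀ b₁ θ τ : ℝ} (h0 : 0 < b₀) (hθ : θ ∈ Set.Icc b₀ b₁)
    (hτ : τ ∈ Set.Icc b₀ b₁) (hx : ∀ i, x i ∈ Set.Icc (0 : ℝ) 1) (a : ι → ℝ) :
    quad (kernMatrix θ x) a ≤
      Real.exp (derivBound b₀ b₁ * (b₁ - b₀)) * quad (kernMatrix τ x) a := by
  set Γ := derivBound b₀ b₁ with hΓ
  have hb : b₀ ≤ b₁ := hθ.1.trans hθ.2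
  have hΓ0 : 0 ≤ Γ := derivBound_nonneg h0 hb
  have hder : ∀ σ ∈ Set.Icc b₀ b₁, HasDerivAt (fun σ => quad (kernMatrix σ x) a)
      (-quad (kernDerivMatrix σ x) a) σ := fun σ hσ => by
    simpa only [pairing_vecMulVec] using
      hasDerivAt_pairing_kernMatrix (h0.trans_le hσ.1) (Matrix.vecMulVec a a) x
  have hbd : ∀ σ ∈ Set.Icc b₀ b₁, quad (kernDerivMatrix σ x) a ∈
      Set.Icc 0 (Γ * quad (kernMatrix σ x) a) := fun σ hσ => by
    have hσ0 := h0.trans_le hσ.1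
    have := pairing_kernDerivMatrix_mem hσ0 hx (W := Matrix.vecMulVec a a)
      (c := quad (kernMatrix σ x) a) (fun v => by rw [quad_vecMulVec]; positivity)
      (fun v k _ h => by rw [quad_vecMulVec]; exact h a)
    rw [pairing_vecMulVec] at this
    exact ⟨this.1, this.2.trans (mul_le_mul_of_nonneg_right (le_derivBound h0 hσ)
      (quad_kernMatrix_nonneg hσ0 hx a))⟩
  have hKτ := quad_kernMatrix_nonneg (h0.trans_le hτ.1) hx a
  rcases le_total τ θ with h | h
  -- The form decreases in the scale, so for τ ≤ θ no exponential factor is needed.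
  · have hanti : AntitoneOn (fun σ => quad (kernMatrix σ x) a) (Set.Icc b₀ b₁) := by
      refine antitoneOn_of_hasDerivWithinAt_nonpos (convex_Icc _ _)
        (fun σ hσ => (hder σ hσ).continuousAt.continuousWithinAt)
        (fun σ hσ => (hder σ (interior_subset hσ)).hasDerivWithinAt) fun σ hσ => ?_
      linarith [(hbd σ (interior_subset hσ)).1]
    refine (hanti hτ hθ h).trans (le_mul_of_one_le_left hKτ (Real.one_le_exp ?_))
    exact mul_nonneg hΓ0 (sub_nonneg.2 hb)
  -- Gronwall: the factor e^{Γσ} compensates the largest possible rate of decrease.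
  · have hmono : MonotoneOn (fun σ => Real.exp (Γ * σ) * quad (kernMatrix σ x) a)
        (Set.Icc b₀ b₁) := by
      have hd : ∀ σ ∈ Set.Icc b₀ b₁,
          HasDerivAt (fun σ => Real.exp (Γ * σ) * quad (kernMatrix σ x) a)
            (Real.exp (Γ * σ) * (Γ * quad (kernMatrix σ x) a - quad (kernDerivMatrix σ x) a)) σ := by
        intro σ hσ
        have h1 : HasDerivAt (fun σ => Real.exp (Γ * σ)) (Real.exp (Γ * σ) * Γ) σ := by
          simpa using ((hasDerivAt_id σ).const_mul Γ).exp
        exact (h1.mul (hder σ hσ)).congr_deriv (by ring)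
      refine monotoneOn_of_hasDerivWithinAt_nonneg (convex_Icc _ _)
        (fun σ hσ => (hd σ hσ).continuousAt.continuousWithinAt)
        (fun σ hσ => (hd σ (interior_subset hσ)).hasDerivWithinAt) fun σ hσ => ?_
      have := (hbd σ (interior_subset hσ)).2
      exact mul_nonneg (Real.exp_nonneg _) (by linarith)
    have := hmono hθ hτ h
    simp only at this
    have h2 : quad (kernMatrix θ x) a ≤ Real.exp (Γ * (τ - θ)) * quad (kernMatrix τ x) a := by
      rw [mul_sub, sub_eq_add_neg, Real.exp_add, mul_right_comm, mul_comm _ (Real.exp (-(Γ * θ))),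
        Real.exp_neg, ← div_eq_inv_mul, le_div_iff₀ (Real.exp_pos _)]
      linarith
    refine h2.trans (mul_le_mul_of_nonneg_right (Real.exp_le_exp.2 ?_) hKτ)
    exact mul_le_mul_of_nonneg_left (by linarith [hτ.2, hθ.1]) hΓ0

end Gram

/-! ### Trace bounds for K_τ⁻¹K_θ. -/

section Trace

lemma kernMatrix_isSymm {ι : Type*} (σ : ℝ) (x : ι → ℝ) : (kernMatrix σ x).IsSymm := by
  ext i j
  simp [kernMatrix, kern, abs_sub_comm]

variable {ι : Type*} [Fintype ι]

lemma pairing_eq_trace {W M : Matrix ι ι ℝ} (hM : M.IsSymm) : pairing W M = (W * M).trace := by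
  simp only [pairing, Matrix.trace, Matrix.diag, Matrix.mul_apply]
  refine Finset.sum_congr rfl fun i _ => Finset.sum_congr rfl fun j _ => ?_
  rw [hM.apply]

variable [DecidableEq ι]

/-- Duality between K and K⁻¹: at a = K⁻¹v both a·v and a'Ka equal q = v'K⁻¹v, so the hypothesis
reads q² ≤ cq. -/
lemma quad_inv_le {K : Matrix ι ι ℝ} (hK : K.PosDef) {v : ι → ℝ} {c : ℝ}
    (hc : 0 ≤ c) (h : ∀ a, (a ⬝ᵥ v) ^ 2 ≤ c * quad K a) : quad K⁻¹ v ≤ c := by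
  have hdet : IsUnit K.det := (Matrix.isUnit_iff_isUnit_det K).1 hK.isUnit
  have h1 := h (K⁻¹.mulVec v)
  have e : quad K (K⁻¹.mulVec v) = quad K⁻¹ v := by
    rw [quad_eq_dotProduct, Matrix.mulVec_mulVec, Matrix.mul_nonsing_inv _ hdet, Matrix.one_mulVec,
      quad_eq_dotProduct, dotProduct_comm]
  rw [e, dotProduct_comm, ← quad_eq_dotProduct] at h1
  nlinarith [sq_nonneg (quad K⁻¹ v - c)]

/-- The trace of `K_τ⁻¹ K_θ` differs from the dimension by a bounded amount. -/
lemma abs_trace_inv_mul_kernMatrix_sub_card_le {x : ι → ℝ} {b₀ b₁ θ τ : ℝ} (h0 : 0 < b₀)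
    (hθ : θ ∈ Set.Icc b₀ b₁)
    (hτ : τ ∈ Set.Icc b₀ b₁) (hx : ∀ i, x i ∈ Set.Icc (0 : ℝ) 1)
    (hK : (kernMatrix τ x).PosDef) :
    |((kernMatrix τ x)⁻¹ * kernMatrix θ x).trace - Fintype.card ι| ≤
      derivBound b₀ b₁ * Real.exp (derivBound b₀ b₁ * (b₁ - b₀)) * (b₁ - b₀) := by
  have hdet : IsUnit (kernMatrix τ x).det := (Matrix.isUnit_iff_isUnit_det _).1 hK.isUnit
  set W := (kernMatrix τ x)⁻¹ with hW
  set E := Real.exp (derivBound b₀ b₁ * (b₁ - b₀)) with hE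
  have hW0 : ∀ v, 0 ≤ quad W v := fun v => by
    rw [quad_eq_dotProduct]
    simpa using hK.inv.posSemidef.dotProduct_mulVec_nonneg v
  have hbd : ∀ σ ∈ Set.Icc b₀ b₁,
      ‖-pairing W (kernDerivMatrix σ x)‖ ≤ derivBound b₀ b₁ * E := by
    intro σ hσ
    have hσ0 := h0.trans_le hσ.1
    have := pairing_kernDerivMatrix_mem hσ0 hx hW0 (c := E) fun v k hk h => by
      refine quad_inv_le hK (mul_nonneg hk (Real.exp_nonneg _)) fun a => (h a).trans ?_
      rw [mul_assoc]
      exact mul_le_mul_of_nonneg_left (quad_kernMatrix_le h0 hσ hτ hx a) hk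
    rw [norm_neg, Real.norm_eq_abs, abs_of_nonneg this.1]
    exact this.2.trans (mul_le_mul_of_nonneg_right (le_derivBound h0 hσ) (Real.exp_nonneg _))
  -- Mean value inequality between τ and θ for σ ↦ tr(K_τ⁻¹K_σ), whose value at τ is the dimension.
  have := (convex_Icc b₀ b₁).norm_image_sub_le_of_norm_hasDerivWithin_le
    (fun σ hσ => (hasDerivAt_pairing_kernMatrix (h0.trans_le hσ.1) W x).hasDerivWithinAt)
    hbd hτ hθ
  rw [pairing_eq_trace (kernMatrix_isSymm _ _), pairing_eq_trace (kernMatrix_isSymm _ _),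
    hW, Matrix.nonsing_inv_mul _ hdet, Matrix.trace_one, ← hW, Real.norm_eq_abs,
    Real.norm_eq_abs] at this
  refine this.trans (mul_le_mul_of_nonneg_left ?_ ?_)
  · rw [abs_le]; constructor <;> linarith [hτ.1, hτ.2, hθ.1, hθ.2]
  · exact mul_nonneg (derivBound_nonneg h0 (hθ.1.trans hθ.2)) (Real.exp_nonneg _)

open scoped MatrixOrder in
lemma exists_eq_conjTranspose_mul_self {A : Matrix ι ι ℝ} (hA : A.PosSemidef) :
    ∃ B : Matrix ι ι ℝ, A = B.conjTranspose * B :=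
  CStarAlgebra.nonneg_iff_eq_star_mul_self.mp hA.nonneg

/-- Write L = V'V. Conjugating the positive semidefinite matrix cK - L by VK⁻¹ and taking the trace
gives the inequality. -/
lemma trace_mul_self_le {K L : Matrix ι ι ℝ} (hK : K.PosDef) (hL : L.PosSemidef) {c : ℝ}
    (h : ∀ a, quad L a ≤ c * quad K a) :
    ((K⁻¹ * L) * (K⁻¹ * L)).trace ≤ c * (K⁻¹ * L).trace := by
  have hdet : IsUnit K.det := (Matrix.isUnit_iff_isUnit_det K).1 hK.isUnit
  have hD : (c • K - L).PosSemidef := by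
    refine Matrix.PosSemidef.of_dotProduct_mulVec_nonneg ?_ fun a => ?_
    · exact (hK.isHermitian.smul (k := c) (by simp [IsSelfAdjoint])).sub hL.isHermitian
    · have := h a
      rw [quad_eq_dotProduct, quad_eq_dotProduct] at this
      rw [Matrix.sub_mulVec, Matrix.smul_mulVec, dotProduct_sub, dotProduct_smul]
      simpa using this
  obtain ⟨V, rfl⟩ := exists_eq_conjTranspose_mul_self hL
  have h2 := (hD.mul_mul_conjTranspose_same (V * K⁻¹)).trace_nonneg
  have hKi : (K⁻¹).conjTranspose = K⁻¹ := hK.isHermitian.inv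
  rw [Matrix.conjTranspose_mul, hKi, Matrix.mul_sub, Matrix.sub_mul, Matrix.trace_sub] at h2
  have e1 : (V * K⁻¹ * (c • K) * (K⁻¹ * V.conjTranspose)).trace =
      c * (K⁻¹ * (V.conjTranspose * V)).trace := by
    rw [Matrix.mul_smul, Matrix.mul_assoc V, Matrix.nonsing_inv_mul _ hdet, Matrix.mul_one,
      Matrix.smul_mul, Matrix.trace_smul, smul_eq_mul, Matrix.trace_mul_comm, Matrix.mul_assoc]
  have e2 : (V * K⁻¹ * (V.conjTranspose * V) * (K⁻¹ * V.conjTranspose)).trace =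
      ((K⁻¹ * (V.conjTranspose * V)) * (K⁻¹ * (V.conjTranspose * V))).trace := by
    simp only [Matrix.mul_assoc]
    rw [Matrix.trace_mul_comm V]
    simp only [Matrix.mul_assoc]
  linarith

end Trace

/-! ### The regular grid and the one-dimensional correlation matrices. -/

/-- The regular grid `1/n, …, n/n`. -/
def grid (n : ℕ) (i : Fin n) : ℝ := (((i : ℕ) + 1 : ℕ) : ℝ) / n

lemma grid_mem (n : ℕ) (i : Fin n) : grid n i ∈ Set.Icc (0 : ℝ) 1 := by
  refine ⟨by unfold grid; positivity, ?_⟩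
  have h : (i : ℕ) + 1 ≤ n := i.isLt
  exact div_le_one_of_le₀ (by exact_mod_cast h) (by positivity)

/-- If m is the last index with a m ≠ 0, test at the grid position just to the left of `grid n m`:
causality kills the earlier terms, and the later coefficients are zero. -/
lemma eq_zero_of_dotProduct_green_eq_zero {σ : ℝ} {n : ℕ} {a : Fin n → ℝ}
    (h : ∀ s ∈ Set.Icc (0 : ℝ) 1, (a ⬝ᵥ fun i => green σ (grid n i - s)) = 0) : a = 0 := by
  rcases Nat.eq_zero_or_pos n with rfl | hn
  · exact Subsingleton.elim _ _
  by_contra hne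
  obtain ⟨i, hi⟩ := Function.ne_iff.1 hne
  let S : Finset (Fin n) := Finset.univ.filter fun i => a i ≠ 0
  have hS : S.Nonempty := ⟨i, by simpa [S] using hi⟩
  set m := S.max' hS with hm
  have hma : a m ≠ 0 := by simpa [S] using S.max'_mem hS
  have hmax : ∀ j, m < j → a j = 0 := fun j hj => by
    by_contra hj'
    exact absurd (S.le_max' j (by simpa [S] using hj')) (not_le.2 hj)
  -- Index m sits at (m + 1)/n, so its left neighbour is m/n, which is 0 when m = 0.
  have hn' : (0 : ℝ) < n := by exact_mod_cast hn
  have hs := h ((m : ℕ) / n) ⟨by positivity,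
    div_le_one_of_le₀ (by exact_mod_cast m.isLt.le) hn'.le⟩
  rw [dotProduct, Finset.sum_eq_single m] at hs
  · rcases mul_eq_zero.1 hs with h' | h'
    · exact hma h'
    · have : 0 < grid n m - (m : ℕ) / n := by
        rw [grid, ← sub_div]
        push_cast
        exact div_pos (by linarith) hn'
      rw [green, max_eq_left this.le] at h'
      exact absurd h' (mul_pos this (Real.exp_pos _)).ne'
  · intro j _ hj
    rcases lt_or_gt_of_ne hj with hj | hj
    · have : grid n j - (m : ℕ) / n ≤ 0 := by
        rw [grid, ← sub_div]
        refine div_nonpos_of_nonpos_of_nonneg ?_ hn'.le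
        have : (j : ℕ) + 1 ≤ m := hj
        exact sub_nonpos.2 (by exact_mod_cast this)
      simp [green, max_eq_right this]
    · simp [hmax j hj]
  · simp

lemma kernMatrix_grid_posDef {σ : ℝ} (hσ : 0 < σ) (n : ℕ) : (kernMatrix σ (grid n)).PosDef := by
  refine Matrix.PosDef.of_dotProduct_mulVec_pos ?_ fun a ha => ?_
  · rw [Matrix.IsHermitian, Matrix.conjTranspose_eq_transpose_of_trivial]
    exact kernMatrix_isSymm _ _
  rw [star_trivial, ← quad_eq_dotProduct]
  refine lt_of_le_of_ne (quad_kernMatrix_nonneg hσ (grid_mem n) a) fun h0 => ha ?_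
  rw [quad_kernMatrix hσ (grid_mem n)] at h0
  have hI := integral_sq_green_nonneg (σ := σ) (x := grid n) a
  have h1 : 0 ≤ 1 / σ * (a ⬝ᵥ fun i => grid n i * Real.exp (-(σ * grid n i))) ^ 2 := by positivity
  have h2 : 0 ≤ 1 / σ * (a ⬝ᵥ fun i => (grid n i + 1 / σ) * Real.exp (-(σ * grid n i))) ^ 2 := by
    positivity
  have hz : ∫ s in (0 : ℝ)..1, (a ⬝ᵥ fun i => green σ (grid n i - s)) ^ 2 = 0 := by linarith
  refine eq_zero_of_dotProduct_green_eq_zero (σ := σ) fun s hs => ?_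
  by_contra hne
  have hcont : Continuous fun s => (a ⬝ᵥ fun i => green σ (grid n i - s)) ^ 2 := by
    refine Continuous.pow (continuous_finsetSum _ fun i _ => continuous_const.mul ?_) 2
    exact (continuous_green σ).comp (by fun_prop)
  exact (intervalIntegral.integral_pos zero_lt_one hcont.continuousOn
    (fun _ _ => sq_nonneg _) ⟨s, hs, by positivity⟩).ne' hz

lemma corrMatrix_eq_smul {θ : ℝ} (hθ : 0 < θ) (n : ℕ) :
    corrMatrix θ n = θ ^ 3 • kernMatrix θ (grid n) := by
  ext i j
  have hn : (0 : ℝ) < n := by exact_mod_cast i.pos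
  have e : |grid n i - grid n j| = |((i : ℕ) : ℝ) - ((j : ℕ) : ℝ)| / n := by
    rw [grid, grid, ← sub_div, abs_div, abs_of_pos hn]
    push_cast
    ring_nf
  simp only [corrMatrix, kernMatrix, kern, Matrix.of_apply, Matrix.smul_apply, smul_eq_mul, e]
  field_simp

lemma corrMatrix_posDef {θ : ℝ} (hθ : 0 < θ) (n : ℕ) : (corrMatrix θ n).PosDef := by
  rw [corrMatrix_eq_smul hθ]
  exact (kernMatrix_grid_posDef hθ n).smul (by positivity)

lemma inv_corrMatrix_mul {θ τ : ℝ} (hθ : 0 < θ) (hτ : 0 < τ) (n : ℕ) :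
    (corrMatrix τ n)⁻¹ * corrMatrix θ n =
      (θ ^ 3 / τ ^ 3) • ((kernMatrix τ (grid n))⁻¹ * kernMatrix θ (grid n)) := by
  have hu : IsUnit (kernMatrix τ (grid n)).det :=
    (Matrix.isUnit_iff_isUnit_det _).1 (kernMatrix_grid_posDef hτ n).isUnit
  have : (corrMatrix τ n)⁻¹ = (τ ^ 3)⁻¹ • (kernMatrix τ (grid n))⁻¹ := by
    rw [corrMatrix_eq_smul hτ]
    refine Matrix.inv_eq_left_inv ?_
    rw [Matrix.smul_mul, Matrix.mul_smul, smul_smul, inv_mul_cancel₀ (by positivity), one_smul,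
      Matrix.nonsing_inv_mul _ hu]
  rw [this, corrMatrix_eq_smul hθ, Matrix.smul_mul, Matrix.mul_smul, smul_smul]
  congr 1
  field_simp

/-- Asymptotics of the traces that govern the mean and the variance in one dimension. -/
lemma exists_trace_bounds {b₀ b₁ : ℝ} (h0 : 0 < b₀) :
    ∃ C : ℝ, 0 ≤ C ∧ ∀ n : ℕ, ∀ θ ∈ Set.Icc b₀ b₁, ∀ τ ∈ Set.Icc b₀ b₁,
      |τ ^ 3 / θ ^ 3 * ((corrMatrix τ n)⁻¹ * corrMatrix θ n).trace - n| ≤ C ∧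
      (τ ^ 3 / θ ^ 3) ^ 2 *
        (((corrMatrix τ n)⁻¹ * corrMatrix θ n) * ((corrMatrix τ n)⁻¹ * corrMatrix θ n)).trace ≤
        C * (n + C) := by
  rcases lt_or_ge b₁ b₀ with hb | hb
  · refine ⟨0, le_rfl, fun n θ hθ => ?_⟩
    exact absurd (hθ.1.trans hθ.2) (not_le.2 hb)
  set E := Real.exp (derivBound b₀ b₁ * (b₁ - b₀)) with hE
  set C₁ := derivBound b₀ b₁ * E * (b₁ - b₀) with hC₁
  have hE0 : 0 ≤ E := Real.exp_nonneg _
  have hC0 : 0 ≤ C₁ :=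
    mul_nonneg (mul_nonneg (derivBound_nonneg h0 hb) hE0) (sub_nonneg.2 hb)
  refine ⟨max E C₁, le_max_of_le_left hE0, fun n θ hθ τ hτ => ?_⟩
  have hθ0 := h0.trans_le hθ.1
  have hτ0 := h0.trans_le hτ.1
  have hK := kernMatrix_grid_posDef hτ0 n
  have hL := kernMatrix_grid_posDef hθ0 n
  have h1 := abs_trace_inv_mul_kernMatrix_sub_card_le h0 hθ hτ (grid_mem n) hK
  rw [Fintype.card_fin, ← hE, ← hC₁] at h1
  have h2 := trace_mul_self_le hK hL.posSemidef (quad_kernMatrix_le h0 hθ hτ (grid_mem n))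
  rw [← hE] at h2
  rw [inv_corrMatrix_mul hθ0 hτ0]
  set T := (kernMatrix τ (grid n))⁻¹ * kernMatrix θ (grid n) with hT
  -- The prefactor in the estimator exactly undoes the normalization by σ³.
  have e : τ ^ 3 / θ ^ 3 * (θ ^ 3 / τ ^ 3) = 1 := by field_simp
  constructor
  · rw [Matrix.trace_smul, smul_eq_mul, ← mul_assoc, e, one_mul]
    exact h1.trans (le_max_right _ _)
  · rw [Matrix.smul_mul, Matrix.mul_smul, smul_smul, Matrix.trace_smul, smul_eq_mul, ← mul_assoc,
      ← sq, ← mul_pow, e, one_pow, one_mul]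
    refine h2.trans ?_
    have h3 : T.trace ≤ n + C₁ := by linarith [(abs_le.1 h1).2]
    calc E * T.trace ≤ E * (n + C₁) := by gcongr
      _ ≤ max E C₁ * (n + max E C₁) := by
        gcongr
        · exact le_max_left _ _
        · exact le_max_right _ _

/-! ### Kronecker products. -/

section Kronecker

variable {d n : ℕ}

lemma kronecker_mul (A B : Fin d → Matrix (Fin n) (Fin n) ℝ) :
    kronecker A * kronecker B = kronecker fun t => A t * B t := by
  ext i j
  simp only [kronecker, Matrix.mul_apply, Matrix.of_apply, Finset.prod_univ_sum,
    Fintype.piFinset_univ, Finset.prod_mul_distrib]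

lemma kronecker_one : kronecker (fun _ : Fin d => (1 : Matrix (Fin n) (Fin n) ℝ)) = 1 := by
  ext i j
  rw [kronecker, Matrix.of_apply, Matrix.one_apply]
  split_ifs with h
  · subst h
    exact Finset.prod_eq_one fun t _ => Matrix.one_apply_eq _
  · obtain ⟨t, ht⟩ := Function.ne_iff.1 h
    exact Finset.prod_eq_zero (Finset.mem_univ t) (Matrix.one_apply_ne ht)

lemma trace_kronecker (A : Fin d → Matrix (Fin n) (Fin n) ℝ) :
    (kronecker A).trace = ∏ t, (A t).trace := by
  simp only [kronecker, Matrix.trace, Matrix.diag, Matrix.of_apply, Finset.prod_univ_sum,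
    Fintype.piFinset_univ]

lemma inv_kronecker {A : Fin d → Matrix (Fin n) (Fin n) ℝ} (hA : ∀ t, (A t).PosDef) :
    (kronecker A)⁻¹ = kronecker fun t => (A t)⁻¹ := by
  refine Matrix.inv_eq_left_inv ?_
  rw [kronecker_mul, ← kronecker_one]
  congr 1
  ext1 t
  exact Matrix.nonsing_inv_mul _ ((Matrix.isUnit_iff_isUnit_det _).1 (hA t).isUnit)

lemma conjTranspose_kronecker (A : Fin d → Matrix (Fin n) (Fin n) ℝ) :
    (kronecker A).conjTranspose = kronecker fun t => (A t).conjTranspose := by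
  ext i j
  simp [kronecker, Matrix.conjTranspose_apply]

/-- Factoring each A t as B'B gives semidefiniteness; the product of the inverses shows
invertibility. -/
lemma posDef_kronecker {A : Fin d → Matrix (Fin n) (Fin n) ℝ} (hA : ∀ t, (A t).PosDef) :
    (kronecker A).PosDef := by
  have hsemi : (kronecker A).PosSemidef := by
    choose B hB using fun t => exists_eq_conjTranspose_mul_self (hA t).posSemidef
    rw [show A = fun t => (B t).conjTranspose * B t from funext hB, ← kronecker_mul,
      ← conjTranspose_kronecker]
    exact Matrix.posSemidef_conjTranspose_mul_self _
  refine hsemi.posDef_iff_isUnit.2 ?_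
  refine (Matrix.isUnit_iff_isUnit_det _).2 (Matrix.isUnit_det_of_left_inverse
    (B := kronecker fun t => (A t)⁻¹) ?_)
  rw [kronecker_mul, ← kronecker_one]
  congr 1
  ext1 t
  exact Matrix.nonsing_inv_mul _ ((Matrix.isUnit_iff_isUnit_det _).1 (hA t).isUnit)

end Kronecker

/-! ### Moments of Gaussian quadratic forms. -/

section GaussianQuadraticForm

variable {ι : Type*} [Fintype ι] [DecidableEq ι]

lemma exists_unitary_diagonalization {H : Matrix ι ι ℝ} (hH : H.IsHermitian) :
    ∃ (U : Matrix ι ι ℝ) (l : ι → ℝ), U * star U = 1 ∧ star U * U = 1 ∧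
      H = U * Matrix.diagonal l * star U := by
  refine ⟨hH.eigenvectorUnitary.1, hH.eigenvalues, Unitary.coe_mul_star_self _,
    Unitary.coe_star_mul_self _, ?_⟩
  have := hH.spectral_theorem
  rw [Unitary.conjStarAlgAut_apply] at this
  exact this

/-- Simultaneous diagonalization of a positive semidefinite and a symmetric form. -/
lemma exists_diagonalization {W S : Matrix ι ι ℝ} (hW : W.PosSemidef) (hS : S.IsHermitian) :
    ∃ (B : Matrix ι ι ℝ) (l : ι → ℝ),
      W = B.conjTranspose * B ∧ B * S * B.conjTranspose = Matrix.diagonal l := by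
  obtain ⟨B, rfl⟩ := exists_eq_conjTranspose_mul_self hW
  have hH : (B * S * B.conjTranspose).IsHermitian :=
    Matrix.isHermitian_mul_mul_conjTranspose B hS
  obtain ⟨U, l, hUU, hUU', hsp⟩ := exists_unitary_diagonalization hH
  refine ⟨star U * B, l, ?_, ?_⟩
  · rw [Matrix.conjTranspose_mul, ← Matrix.star_eq_conjTranspose (star U), star_star,
      Matrix.mul_assoc, ← Matrix.mul_assoc U, hUU, Matrix.one_mul]
  · rw [Matrix.conjTranspose_mul, ← Matrix.star_eq_conjTranspose (star U), star_star]
    calc star U * B * S * (B.conjTranspose * U)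
        = star U * (B * S * B.conjTranspose) * U := by simp only [Matrix.mul_assoc]
      _ = (star U * U) * Matrix.diagonal l * (star U * U) := by
          rw [hsp]; simp only [Matrix.mul_assoc]
      _ = _ := by rw [hUU', Matrix.one_mul, Matrix.mul_one]

variable {Ω : Type*} [MeasurableSpace Ω] {P : Measure Ω}

/-- The fourth moment of the standard normal distribution. -/
def fourthMoment : ℝ := ∫ z, z ^ 4 ∂(gaussianReal 0 1)

lemma fourthMoment_nonneg : 0 ≤ fourthMoment :=
  integral_nonneg fun z => by positivity

lemma integral_pow_four_gaussian {Z : Ω → ℝ} (hZ : HasGaussianLaw Z P) (h0 : ∫ ω, Z ω ∂P = 0) :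
    ∫ ω, Z ω ^ 4 ∂P = Var[Z; P] ^ 2 * fourthMoment := by
  have hmap := hZ.map_eq_gaussianReal
  rw [h0] at hmap
  have hv := variance_nonneg Z P
  have h1 : P.map Z = (gaussianReal 0 1).map (√(Var[Z; P]) * ·) := by
    rw [hmap, gaussianReal_map_const_mul]
    congr 1
    · simp
    · ext
      simp [Real.sq_sqrt hv, hv]
  have h2 : ∫ ω, Z ω ^ 4 ∂P = ∫ z, z ^ 4 ∂(P.map Z) :=
    (integral_map hZ.aemeasurable (f := fun z : ℝ => z ^ 4) (by fun_prop)).symm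
  rw [h2, h1, integral_map (by fun_prop) (by fun_prop)]
  simp only [mul_pow]
  rw [integral_const_mul, fourthMoment, show √(Var[Z; P]) ^ 4 = (√(Var[Z; P]) ^ 2) ^ 2 by ring,
    Real.sq_sqrt hv]

lemma memLp_sq_gaussian {Z : Ω → ℝ} (hZ : HasGaussianLaw Z P) :
    MemLp (fun ω => Z ω ^ 2) 2 P := by
  have h : MemLp Z 4 P := hZ.memLp (by simp)
  have : ENNReal.HolderTriple 4 4 2 := ⟨by
    rw [← two_mul, show (4 : ℝ≥0∞) = 2 * 2 by norm_num,
      ENNReal.mul_inv (by simp) (by simp), ← mul_assoc,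
      ENNReal.mul_inv_cancel (by simp) (by simp), one_mul]⟩
  rw [show (fun ω => Z ω ^ 2) = Z * Z by ext ω; simp [sq]]
  exact h.mul (p := 4) (q := 4) (r := 2) h

/-- Dropping the squared mean of Z² costs only a constant factor, which is harmless for an O-bound.
-/
lemma variance_sq_gaussian_le {Z : Ω → ℝ} (hZ : HasGaussianLaw Z P) (h0 : ∫ ω, Z ω ∂P = 0) :
    Var[fun ω => Z ω ^ 2; P] ≤ fourthMoment * Var[Z; P] ^ 2 := by
  have := hZ.isProbabilityMeasure
  refine (variance_le_expectation_sq (memLp_sq_gaussian hZ).aestronglyMeasurable).trans ?_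
  rw [mul_comm, ← integral_pow_four_gaussian hZ h0]
  refine le_of_eq (integral_congr_ae (.of_forall fun ω => ?_))
  simp only [Pi.pow_apply]
  ring

/-- The mean and the variance of a positive semidefinite quadratic form in a centred Gaussian
vector. -/
lemma gaussian_quadratic_form {x : ι → Ω → ℝ} (hx : HasGaussianLaw (fun ω => (x · ω)) P)
    (h0 : ∀ i, ∫ ω, x i ω ∂P = 0) {S : Matrix ι ι ℝ} (hS : ∀ i j, cov[x i, x j; P] = S i j)
    {W : Matrix ι ι ℝ} (hW : W.PosSemidef) :
    MemLp (fun ω => (x · ω) ⬝ᵥ W.mulVec (x · ω)) 2 P ∧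
    ∫ ω, (x · ω) ⬝ᵥ W.mulVec (x · ω) ∂P = (W * S).trace ∧
    Var[fun ω => (x · ω) ⬝ᵥ W.mulVec (x · ω); P] ≤
      fourthMoment * ((W * S) * (W * S)).trace := by
  have hP := hx.isProbabilityMeasure
  have hSH : S.IsHermitian := by
    ext i j
    simp [Matrix.conjTranspose_apply, ← hS, covariance_comm]
  obtain ⟨B, l, rfl, hl⟩ := exists_diagonalization hW hSH
  -- The coordinates of Bx are jointly Gaussian with diagonal covariance, hence independent, and the
  -- form is the sum of their squares.
  set z : ι → Ω → ℝ := fun k ω => ∑ i, B k i * x i ω with hz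
  have hzG : HasGaussianLaw (fun ω => (z · ω)) P :=
    hx.map_fun (Matrix.mulVecLin B).toContinuousLinearMap
  have hx2 : ∀ i, MemLp (x i) 2 P := fun i => (hx.eval i).memLp_two
  have hz0 : ∀ k, ∫ ω, z k ω ∂P = 0 := fun k => by
    simp only [hz]
    rw [integral_finsetSum _ fun i _ => ((hx.eval i).integrable).const_mul _]
    simp [integral_const_mul, h0]
  have hzc : ∀ k m, cov[z k, z m; P] = Matrix.diagonal l k m := fun k m => by
    rw [← hl]
    simp only [hz]
    rw [covariance_fun_sum_fun_sum (fun i => (hx2 i).const_mul _) (fun i => (hx2 i).const_mul _)]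
    simp only [covariance_const_mul_left, covariance_const_mul_right, hS, Matrix.mul_apply,
      Matrix.conjTranspose_apply, star_trivial, Finset.sum_mul]
    rw [Finset.sum_comm]
    exact Finset.sum_congr rfl fun i _ => Finset.sum_congr rfl fun j _ => by ring
  have hzv : ∀ k, Var[z k; P] = l k := fun k => by
    rw [← covariance_self (hzG.eval k).aemeasurable, hzc, Matrix.diagonal_apply_eq]
  have hind : iIndepFun z P := hzG.iIndepFun_of_covariance_eq_zero fun i j hij => by
    rw [hzc, Matrix.diagonal_apply_ne _ hij]
  have hq : ∀ ω, (x · ω) ⬝ᵥ (B.conjTranspose * B).mulVec (x · ω) = ∑ k, z k ω ^ 2 := fun ω => by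
    rw [← Matrix.mulVec_mulVec, Matrix.dotProduct_mulVec,
      Matrix.conjTranspose_eq_transpose_of_trivial, Matrix.vecMul_transpose]
    simp [dotProduct, Matrix.mulVec, hz, sq]
  simp only [hq]
  have hL2 : ∀ k, MemLp (fun ω => z k ω ^ 2) 2 P := fun k => memLp_sq_gaussian (hzG.eval k)
  have ht : ∀ T : Matrix ι ι ℝ, (B.conjTranspose * B * T).trace = (B * T * B.conjTranspose).trace :=
    fun T => by rw [Matrix.mul_assoc, Matrix.trace_mul_comm]
  refine ⟨memLp_finsetSum _ fun k _ => hL2 k, ?_, ?_⟩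
  · rw [integral_finsetSum _ fun k _ => (hL2 k).integrable one_le_two, ht, hl,
      Matrix.trace_diagonal]
    refine Finset.sum_congr rfl fun k _ => ?_
    rw [← hzv, variance_of_integral_eq_zero (hzG.eval k).aemeasurable (hz0 k)]
  · have e : (B.conjTranspose * B * S * (B.conjTranspose * B * S)).trace = ∑ k, l k ^ 2 := by
      rw [show B.conjTranspose * B * S * (B.conjTranspose * B * S) =
        B.conjTranspose * B * (S * (B.conjTranspose * B * S)) by simp only [Matrix.mul_assoc], ht,
        show B * (S * (B.conjTranspose * B * S)) * B.conjTranspose =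
          (B * S * B.conjTranspose) * (B * S * B.conjTranspose) by simp only [Matrix.mul_assoc],
        hl, Matrix.diagonal_mul_diagonal, Matrix.trace_diagonal]
      simp only [sq]
    have hv := IndepFun.variance_sum (μ := P) (X := fun k ω => z k ω ^ 2) (s := Finset.univ)
      (fun k _ => hL2 k) fun i _ j _ hij =>
        (hind.indepFun hij).comp (φ := fun y => y ^ 2) (ψ := fun y => y ^ 2)
          (by fun_prop) (by fun_prop)
    have hs : (fun ω => ∑ k, z k ω ^ 2) = ∑ k, fun ω => z k ω ^ 2 := by
      ext ω; simp
    rw [hs, hv, e, Finset.mul_sum]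
    refine Finset.sum_le_sum fun k _ => ?_
    rw [← hzv]
    exact variance_sq_gaussian_le (hzG.eval k) (hz0 k)

end GaussianQuadraticForm

/-- With A = B'B the trace is the squared Frobenius norm of BSB'. The sign is needed to multiply the
coordinatewise variance bounds. -/
lemma trace_mul_self_nonneg {ι : Type*} [Fintype ι] [DecidableEq ι] {A S : Matrix ι ι ℝ}
    (hA : A.PosSemidef) (hS : S.IsHermitian) : 0 ≤ ((A * S) * (A * S)).trace := by
  obtain ⟨B, rfl⟩ := exists_eq_conjTranspose_mul_self hA
  have hH : (B * S * B.conjTranspose).IsHermitian :=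
    Matrix.isHermitian_mul_mul_conjTranspose B hS
  have h := (Matrix.posSemidef_conjTranspose_mul_self (B * S * B.conjTranspose)).trace_nonneg
  rw [hH.eq] at h
  refine h.trans_eq ?_
  simp only [Matrix.mul_assoc]
  rw [Matrix.trace_mul_comm B.conjTranspose]
  simp only [Matrix.mul_assoc]

/-! ### The observed field: covariance, moments and nondegeneracy. -/

/-- The constant in front of the product of correlations in the covariance at `φ = 1`. -/
def scale {d : ℕ} (θ : Fin d → ℝ) : ℝ := Real.pi ^ d / (2 ^ d * ∏ t, θ t ^ 3)

variable {d : ℕ} {θ θ' : Fin d → ℝ} {φ : ℝ}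

lemma scale_pos (hθ : ∀ t, 0 < θ t) : 0 < scale θ := by
  have : 0 < ∏ t, θ t ^ 3 := Finset.prod_pos fun t _ => pow_pos (hθ t) 3
  unfold scale
  positivity

lemma covMatrix_eq (φ : ℝ) (θ : Fin d → ℝ) (n : ℕ) :
    covMatrix φ θ n = (scale θ * φ ^ d) • kronecker fun t => corrMatrix (θ t) n := by
  rw [covMatrix, scale]
  congr 1
  ring

lemma quadForm_eq (θ : Fin d → ℝ) (n : ℕ) (x : (Fin d → Fin n) → ℝ) :
    quadForm θ n x = (scale θ * (n : ℝ) ^ d)⁻¹ *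
      (x ⬝ᵥ ((kronecker fun t => corrMatrix (θ t) n)⁻¹.mulVec x)) := by
  rw [quadForm, scale, div_mul_eq_mul_div (Real.pi ^ d), inv_div]

lemma covFun_gridPoint (φ : ℝ) (θ : Fin d → ℝ) (n : ℕ) (i j : Fin d → Fin n) :
    covFun φ θ (gridPoint n i) (gridPoint n j) = covMatrix φ θ n i j := by
  simp only [covFun, covMatrix, kronecker, corrMatrix, gridPoint, Matrix.smul_apply,
    Matrix.of_apply, smul_eq_mul]
  congr 1
  refine Finset.prod_congr rfl fun t _ => ?_
  have hn : (0 : ℝ) < n := by exact_mod_cast (i t).pos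
  rw [← sub_div, abs_div, abs_of_pos hn]
  push_cast
  rw [add_sub_add_right_eq_sub, mul_div_assoc]

lemma posDef_kronecker_corrMatrix (hθ : ∀ t, 0 < θ t) (n : ℕ) :
    (kronecker fun t => corrMatrix (θ t) n).PosDef :=
  posDef_kronecker fun t => corrMatrix_posDef (hθ t) n

lemma inv_mul_covMatrix (hθ' : ∀ t, 0 < θ' t) (n : ℕ) :
    (kronecker fun t => corrMatrix (θ' t) n)⁻¹ * covMatrix φ θ n =
      (scale θ * φ ^ d) •
        kronecker fun t => (corrMatrix (θ' t) n)⁻¹ * corrMatrix (θ t) n := by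
  rw [covMatrix_eq, Matrix.mul_smul, inv_kronecker fun t => corrMatrix_posDef (hθ' t) n,
    kronecker_mul]

lemma scale_div_scale (hθ : ∀ t, 0 < θ t) (hθ' : ∀ t, 0 < θ' t) :
    scale θ / scale θ' = ∏ t, θ' t ^ 3 / θ t ^ 3 := by
  have h1 : 0 < ∏ t, θ t ^ 3 := Finset.prod_pos fun t _ => pow_pos (hθ t) 3
  have h2 : 0 < ∏ t, θ' t ^ 3 := Finset.prod_pos fun t _ => pow_pos (hθ' t) 3
  rw [Finset.prod_div_distrib, scale, scale]
  field_simp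

lemma prod_div_const (f : Fin d → ℝ) (c : ℝ) : ∏ t, f t / c = (∏ t, f t) / c ^ d := by
  simp [Finset.prod_div_distrib]

section Probability

variable {Ω : Type*} [MeasurableSpace Ω] {P : Measure Ω}
  {X : Set.Icc (0 : Fin d → ℝ) 1 → Ω → ℝ}

lemma IsMaternField.hasGaussianLaw_obs (hX : IsMaternField φ θ X P) (n : ℕ) :
    HasGaussianLaw (fun ω => (fun i => X (gridPoint n i) ω)) P := by
  classical
  let I : Finset (Set.Icc (0 : Fin d → ℝ) 1) := Finset.univ.image (gridPoint n)
  have hI : ∀ i, gridPoint n i ∈ I := fun i => Finset.mem_image_of_mem _ (Finset.mem_univ i)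
  exact (hX.gaussian.hasGaussianLaw I).map_fun
    (ContinuousLinearMap.pi fun i => ContinuousLinearMap.proj (⟨gridPoint n i, hI i⟩ : I))

lemma IsMaternField.cov_obs (hX : IsMaternField φ θ X P) (n : ℕ) (i j : Fin d → Fin n) :
    cov[X (gridPoint n i), X (gridPoint n j); P] = covMatrix φ θ n i j := by
  rw [hX.cov_eq, covFun_gridPoint]

lemma IsMaternField.moments (hX : IsMaternField φ θ X P) (hθ : ∀ t, 0 < θ t)
    (hθ' : ∀ t, 0 < θ' t) (n : ℕ) :
    MemLp (fun ω => quadForm θ' n (obs X n ω)) 2 P ∧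
    ∫ ω, quadForm θ' n (obs X n ω) ∂P = φ ^ d * ∏ t,
      (θ' t ^ 3 / θ t ^ 3 * ((corrMatrix (θ' t) n)⁻¹ * corrMatrix (θ t) n).trace) / n ∧
    variance (fun ω => quadForm θ' n (obs X n ω)) P ≤ fourthMoment * (φ ^ d) ^ 2 * ∏ t,
      ((θ' t ^ 3 / θ t ^ 3) ^ 2 * (((corrMatrix (θ' t) n)⁻¹ * corrMatrix (θ t) n) *
        ((corrMatrix (θ' t) n)⁻¹ * corrMatrix (θ t) n)).trace) / (n : ℝ) ^ 2 := by
  obtain ⟨h1, h2, h3⟩ := gaussian_quadratic_form (hX.hasGaussianLaw_obs n)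
    (fun i => hX.mean_zero _) (hX.cov_obs n) (posDef_kronecker_corrMatrix hθ' n).inv.posSemidef
  rw [inv_mul_covMatrix hθ', Matrix.trace_smul, trace_kronecker] at h2
  rw [inv_mul_covMatrix hθ', Matrix.smul_mul, Matrix.mul_smul, smul_smul, kronecker_mul,
    Matrix.trace_smul, trace_kronecker] at h3
  have hs := scale_div_scale hθ hθ'
  have hp := scale_pos hθ'
  simp only [quadForm_eq]
  refine ⟨h1.const_mul _, ?_, ?_⟩
  · refine (integral_const_mul _ _).trans ?_
    rw [show ∫ ω, obs X n ω ⬝ᵥ (kronecker fun t => corrMatrix (θ' t) n)⁻¹.mulVec (obs X n ω) ∂P = _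
      from h2, prod_div_const, Finset.prod_mul_distrib, ← hs, smul_eq_mul]
    ring
  · rw [variance_const_mul]
    refine (mul_le_mul_of_nonneg_left h3 (sq_nonneg _)).trans_eq ?_
    rw [prod_div_const, Finset.prod_mul_distrib, Finset.prod_pow, ← hs, smul_eq_mul]
    ring

/-- A single coordinate suffices: it is Gaussian with positive variance, so it has no atom at 0. -/
lemma IsMaternField.ae_obs_ne_zero (hX : IsMaternField φ θ X P) (hθ : ∀ t, 0 < θ t) (hφ : 0 < φ)
    {n : ℕ} (hn : 1 ≤ n) : ∀ᵐ ω ∂P, obs X n ω ≠ 0 := by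
  let i : Fin d → Fin n := fun _ => ⟨0, hn⟩
  have hG := hX.gaussian.hasGaussianLaw_eval (gridPoint n i)
  have hv : 0 < Var[X (gridPoint n i); P] := by
    rw [← covariance_self hG.aemeasurable, hX.cov_obs, covMatrix_eq, Matrix.smul_apply,
      smul_eq_mul]
    have := (posDef_kronecker_corrMatrix hθ n).diag_pos (i := i)
    have := scale_pos hθ
    positivity
  have hmap := hG.map_eq_gaussianReal
  have hne : Var[X (gridPoint n i); P].toNNReal ≠ 0 := by simpa using hv
  have h0 : P.map (X (gridPoint n i)) {0} = 0 := by
    rw [hmap]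
    have := nullSingletonClass_gaussianReal (μ := P[X (gridPoint n i)]) hne
    exact measure_singleton 0
  rw [Measure.map_apply_of_aemeasurable hG.aemeasurable (measurableSet_singleton 0)] at h0
  filter_upwards [measure_eq_zero_iff_ae_notMem.1 h0] with ω hω hz
  exact hω (congrFun hz i)

end Probability

/-! ### Maximization of the likelihood. -/

section Likelihood

variable {n : ℕ} {x : (Fin d → Fin n) → ℝ}

lemma quadForm_pos (hθ : ∀ t, 0 < θ t) (hn : 1 ≤ n) (hx : x ≠ 0) : 0 < quadForm θ n x := by
  have h1 := (posDef_kronecker_corrMatrix hθ n).inv.dotProduct_mulVec_pos hx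
  have h2 := scale_pos hθ
  have h3 : (0 : ℝ) < n := by exact_mod_cast hn
  rw [star_trivial] at h1
  rw [quadForm_eq]
  positivity

lemma likelihood_pos (hθ : ∀ t, 0 < θ t) {ψ : ℝ} (hψ : 0 < ψ) :
    0 < likelihood n x ψ θ := by
  have h2 := scale_pos hθ
  have hdet : 0 < (covMatrix ψ θ n).det := by
    rw [covMatrix_eq]
    exact ((posDef_kronecker_corrMatrix hθ n).smul (by positivity)).det_pos
  unfold likelihood
  positivity

/-- Isolates the dependence on ψ: it enters only through log u + Q/u with u = ψ^d. -/
lemma log_likelihood (hθ : ∀ t, 0 < θ t) (hn : 1 ≤ n) {ψ : ℝ} (hψ : 0 < ψ) :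
    Real.log (likelihood n x ψ θ) =
      Real.log ((2 * Real.pi) ^ (-((n : ℝ) ^ d / 2))) -
        ((n : ℝ) ^ d * Real.log (scale θ) +
          Real.log (kronecker fun t => corrMatrix (θ t) n).det) / 2 -
        (n : ℝ) ^ d / 2 * (Real.log (ψ ^ d) + quadForm θ n x / ψ ^ d) := by
  have h2 := scale_pos hθ
  have h3 : (0 : ℝ) < n := by exact_mod_cast hn
  have hK := posDef_kronecker_corrMatrix hθ n
  have hD := hK.det_pos
  have hu : IsUnit (kronecker fun t => corrMatrix (θ t) n).det :=
    (Matrix.isUnit_iff_isUnit_det _).1 hK.isUnit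
  have hdet : (covMatrix ψ θ n).det =
      (scale θ * ψ ^ d) ^ (n ^ d) * (kronecker fun t => corrMatrix (θ t) n).det := by
    rw [covMatrix_eq, Matrix.det_smul]
    simp
  have hinv : (covMatrix ψ θ n)⁻¹ =
      (scale θ * ψ ^ d)⁻¹ • (kronecker fun t => corrMatrix (θ t) n)⁻¹ := by
    rw [covMatrix_eq]
    refine Matrix.inv_eq_left_inv ?_
    rw [Matrix.smul_mul, Matrix.mul_smul, smul_smul, inv_mul_cancel₀ (by positivity), one_smul,
      Matrix.nonsing_inv_mul _ hu]
  have hq : x ⬝ᵥ (covMatrix ψ θ n)⁻¹.mulVec x = (n : ℝ) ^ d * (quadForm θ n x / ψ ^ d) := by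
    rw [hinv, Matrix.smul_mulVec, dotProduct_smul, quadForm_eq, smul_eq_mul]
    field_simp
  have hdet0 : 0 < (covMatrix ψ θ n).det := by rw [hdet]; positivity
  rw [likelihood, Real.log_mul (by positivity) (by positivity),
    Real.log_mul (by positivity) (by positivity), Real.log_exp, Real.log_rpow hdet0, hq, hdet,
    Real.log_mul (by positivity) (by positivity), Real.log_pow,
    Real.log_mul (by positivity) (by positivity)]
  push_cast
  ring

lemma phiHat_pow (hd : 1 ≤ d) (hθ : ∀ t, 0 < θ t) (hn : 1 ≤ n) (hx : x ≠ 0) :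
    phiHat θ n x ^ d = quadForm θ n x := by
  rw [phiHat, one_div, Real.rpow_inv_natCast_pow (quadForm_pos hθ hn hx).le (by lia)]

lemma phiHat_pos (hθ : ∀ t, 0 < θ t) (hn : 1 ≤ n) (hx : x ≠ 0) : 0 < phiHat θ n x :=
  Real.rpow_pos_of_pos (quadForm_pos hθ hn hx) _

lemma likelihood_lt (hd : 1 ≤ d) (hθ : ∀ t, 0 < θ t) (hn : 1 ≤ n) (hx : x ≠ 0) {ψ : ℝ}
    (hψ : 0 < ψ) (hne : ψ ≠ phiHat θ n x) :
    likelihood n x ψ θ < likelihood n x (phiHat θ n x) θ := by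
  have hφ := phiHat_pos hθ hn hx
  have hQ := quadForm_pos hθ hn hx
  have hn0 : (0 : ℝ) < n := by exact_mod_cast hn
  rw [← Real.log_lt_log_iff (likelihood_pos hθ hψ) (likelihood_pos hθ hφ),
    log_likelihood hθ hn hψ, log_likelihood hθ hn hφ, phiHat_pow hd hθ hn hx]
  have hψd : 0 < ψ ^ d := by positivity
  have hne' : quadForm θ n x / ψ ^ d ≠ 1 := by
    rw [Ne, div_eq_one_iff_eq hψd.ne']
    intro h
    apply hne
    rw [phiHat, h, one_div, Real.pow_rpow_inv_natCast hψ.le (by lia)]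
  -- With t = Q/ψ^d, log t < t - 1 says that log u + Q/u at u = ψ^d exceeds its value log Q + 1 at u
  -- = Q.
  have h := Real.log_lt_sub_one_of_pos (div_pos hQ hψd) hne'
  rw [Real.log_div hQ.ne' hψd.ne'] at h
  rw [div_self hQ.ne']
  have : (n : ℝ) ^ d / 2 * (Real.log (quadForm θ n x) + 1) <
      (n : ℝ) ^ d / 2 * (Real.log (ψ ^ d) + quadForm θ n x / ψ ^ d) :=
    mul_lt_mul_of_pos_left (by linarith) (by positivity)
  linarith

end Likelihood

/-! ### Convergence in probability. -/

section Consistency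

variable {Ω : Type*} [MeasurableSpace Ω] {P : Measure Ω}

lemma tendstoInMeasure_const_of_variance [IsProbabilityMeasure P] {Q : ℕ → Ω → ℝ} {m : ℝ} (hQ : ∀ n, MemLp (Q n) 2 P)
    (hm : Tendsto (fun n => ∫ ω, Q n ω ∂P) atTop (𝓝 m))
    (hv : Tendsto (fun n => variance (Q n) P) atTop (𝓝 0)) :
    TendstoInMeasure P Q atTop fun _ => m := by
  rw [tendstoInMeasure_iff_dist]
  intro ε hε
  -- Half of ε goes to the deviation from the mean (Chebyshev), half to the distance of the mean
  -- from m.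
  have hlim : Tendsto (fun n => ENNReal.ofReal (variance (Q n) P / (ε / 2) ^ 2)) atTop (𝓝 0) := by
    simpa using ENNReal.tendsto_ofReal (hv.div_const ((ε / 2) ^ 2))
  refine tendsto_of_tendsto_of_tendsto_of_le_of_le' tendsto_const_nhds hlim
    (.of_forall fun _ => zero_le) ?_
  filter_upwards [Metric.tendsto_nhds.1 hm (ε / 2) (by positivity)] with n hn
  refine (measure_mono fun ω hω => ?_).trans
    (meas_ge_le_variance_div_sq (hQ n) (c := ε / 2) (by positivity))
  simp only [Set.mem_ofPred_eq] at hω ⊢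
  have := dist_triangle (Q n ω) (∫ ω, Q n ω ∂P) m
  rw [← Real.dist_eq]
  linarith

lemma TendstoInMeasure.comp_continuousAt {Q : ℕ → Ω → ℝ} {m : ℝ} {g : ℝ → ℝ}
    (h : TendstoInMeasure P Q atTop fun _ => m) (hg : ContinuousAt g m) :
    TendstoInMeasure P (fun n ω => g (Q n ω)) atTop fun _ => g m := by
  rw [tendstoInMeasure_iff_dist] at h ⊢
  intro ε hε
  obtain ⟨δ, hδ, hδ'⟩ := Metric.continuousAt_iff.1 hg ε hε
  refine tendsto_of_tendsto_of_tendsto_of_le_of_le tendsto_const_nhds (h δ hδ)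
    (fun _ => zero_le) fun n => measure_mono fun ω hω => ?_
  by_contra hlt
  exact absurd (hδ' (not_le.1 hlt)) (not_lt.2 hω)

end Consistency

lemma abs_prod_sub_one_le {f : Fin d → ℝ} {C : ℝ} {n : ℕ} (hC : 0 ≤ C) (hn : 1 ≤ n)
    (hf : ∀ t, |f t - 1| ≤ C / n) : |∏ t, f t - 1| ≤ d * C * Real.exp (d * C) / n := by
  have hn0 : (1 : ℝ) ≤ n := by exact_mod_cast hn
  -- This is |∏(1 + xₜ) - 1| ≤ exp(Σ|xₜ|) - 1; then e^y - 1 ≤ y e^y retains the factor 1/n.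
  have h := Finset.univ.norm_prod_one_add_sub_one_le fun t => f t - 1
  simp only [add_sub_cancel, Real.norm_eq_abs] at h
  have hs : ∑ t, |f t - 1| ≤ d * C / n := by
    calc ∑ t, |f t - 1| ≤ ∑ _t : Fin d, C / n := Finset.sum_le_sum fun t _ => hf t
      _ = d * C / n := by simp [mul_div_assoc]
  set y : ℝ := d * C / n with hy
  have hy0 : 0 ≤ y := by positivity
  have hy1 : y ≤ d * C := div_le_self (by positivity) hn0
  have h1 : Real.exp y - 1 ≤ y * Real.exp y := by
    have := Real.one_sub_le_exp_neg y
    have h2 : (1 - y) * Real.exp y ≤ Real.exp (-y) * Real.exp y := by gcongr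
    rw [← Real.exp_add, neg_add_cancel, Real.exp_zero] at h2
    linarith
  calc |∏ t, f t - 1| ≤ Real.exp (∑ t, |f t - 1|) - 1 := h
    _ ≤ Real.exp y - 1 := by gcongr
    _ ≤ y * Real.exp y := h1
    _ ≤ y * Real.exp (d * C) := by gcongr
    _ = _ := by rw [hy]; ring

/-- The traces are controlled uniformly over all coordinate directions. -/
lemma exists_trace_bounds_pi {b₀ b₁ : Fin d → ℝ} (h0 : ∀ t, 0 < b₀ t) :
    ∃ C : ℝ, 0 ≤ C ∧ ∀ n : ℕ, ∀ t, ∀ θ ∈ Set.Icc (b₀ t) (b₁ t), ∀ τ ∈ Set.Icc (b₀ t) (b₁ t),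
      |τ ^ 3 / θ ^ 3 * ((corrMatrix τ n)⁻¹ * corrMatrix θ n).trace - n| ≤ C ∧
      (τ ^ 3 / θ ^ 3) ^ 2 *
        (((corrMatrix τ n)⁻¹ * corrMatrix θ n) * ((corrMatrix τ n)⁻¹ * corrMatrix θ n)).trace ≤
        C * (n + C) := by
  choose c hc0 hc using fun t => exists_trace_bounds (b₀ := b₀ t) (b₁ := b₁ t) (h0 t)
  refine ⟨∑ t, c t, Finset.sum_nonneg fun t _ => hc0 t, fun n t θ hθ τ hτ => ?_⟩
  have hle : c t ≤ ∑ t, c t := Finset.single_le_sum (fun t _ => hc0 t) (Finset.mem_univ t)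
  have h00 := hc0 t
  have h00' := h00.trans hle
  obtain ⟨h1, h2⟩ := hc t n θ hθ τ hτ
  exact ⟨h1.trans hle, h2.trans (by gcongr)⟩

end MaternField

end

open MaternField

/-! ### Assembly of the theorem. -/

theorem theorem9 (d : ℕ) (hd : 1 ≤ d) (β₀ β₁ : Fin (d + 1) → ℝ)
    (hβ : ∀ t, 0 < β₀ t ∧ β₀ t < β₁ t) :
    ∃ (C : ℝ) (N : ℕ), ∀ (φ : ℝ) (θ θ' : Fin d → ℝ),
      φ ∈ Set.Ioo (β₀ 0) (β₁ 0) →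
      (∀ t : Fin d, θ t ∈ Set.Ioo (β₀ t.succ) (β₁ t.succ)) →
      (∀ t : Fin d, θ' t ∈ Set.Ioo (β₀ t.succ) (β₁ t.succ)) →
      ∀ {Ω : Type*} [MeasurableSpace Ω] (P : Measure Ω) [IsProbabilityMeasure P]
        (X : Set.Icc (0 : Fin d → ℝ) 1 → Ω → ℝ), IsMaternField φ θ X P →
        -- the quadratic form is square integrable, with mean `φ^d + O(1/n)` and variance `O(1/n^d)`
        (∀ n : ℕ, MemLp (fun ω => quadForm θ' n (obs X n ω)) 2 P) ∧
        (∀ n : ℕ, N ≤ n →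
          |(∫ ω, quadForm θ' n (obs X n ω) ∂P) - φ ^ d| ≤ C / n) ∧
        (∀ n : ℕ, N ≤ n →
          variance (fun ω => quadForm θ' n (obs X n ω)) P ≤ C / (n : ℝ) ^ d) ∧
        -- the estimator is almost surely the unique maximizer of `ψ ↦ L_n(ψ, θ')` over `ψ > 0`
        (∀ n : ℕ, 1 ≤ n → ∀ᵐ ω ∂P, 0 < phiHat θ' n (obs X n ω) ∧
          ∀ ψ : ℝ, 0 < ψ → ψ ≠ phiHat θ' n (obs X n ω) →
            likelihood n (obs X n ω) ψ θ' <
              likelihood n (obs X n ω) (phiHat θ' n (obs X n ω)) θ') ∧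
        -- the estimator converges to `φ` in probability
        TendstoInMeasure P (fun n ω => phiHat θ' n (obs X n ω)) atTop (fun _ => φ) := by
  obtain ⟨c, hc0, hc⟩ := exists_trace_bounds_pi (b₀ := fun t : Fin d => β₀ t.succ)
    (b₁ := fun t : Fin d => β₁ t.succ) fun t => (hβ _).1
  have hβ1 : 0 < β₁ 0 := (hβ 0).1.trans (hβ 0).2
  have hm4 := fourthMoment_nonneg
  -- C₁ comes from `abs_prod_sub_one_le` for the mean, and C₂ from multiplying d factors c(1 + c)/n
  -- for the variance. Neither involves the field or its probability space.
  set C₁ : ℝ := β₁ 0 ^ d * (d * c * Real.exp (d * c)) with hC₁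
  set C₂ : ℝ := fourthMoment * (β₁ 0 ^ d) ^ 2 * (c * (1 + c)) ^ d with hC₂
  have hC₁0 : 0 ≤ C₁ := by positivity
  have hC₂0 : 0 ≤ C₂ := by positivity
  refine ⟨C₁ + C₂, 1, fun φ θ θ' hφ hθ hθ' Ω _ P _ X hX => ?_⟩
  have hφ0 : 0 < φ := (hβ 0).1.trans hφ.1
  have hθ0 : ∀ t, 0 < θ t := fun t => (hβ _).1.trans (hθ t).1
  have hθ'0 : ∀ t, 0 < θ' t := fun t => (hβ _).1.trans (hθ' t).1
  have hmom := hX.moments hθ0 hθ'0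
  have hφd : φ ^ d ≤ β₁ 0 ^ d := pow_le_pow_left₀ hφ0.le hφ.2.le d
  have hmean : ∀ n : ℕ, 1 ≤ n →
      |(∫ ω, quadForm θ' n (obs X n ω) ∂P) - φ ^ d| ≤ (C₁ + C₂) / n := by
    intro n hn
    have hn0 : (0 : ℝ) < n := by exact_mod_cast hn
    rw [(hmom n).2.1, ← mul_sub_one, abs_mul, abs_of_pos (pow_pos hφ0 d)]
    have hp := abs_prod_sub_one_le (f := fun t => (θ' t ^ 3 / θ t ^ 3 *
      ((corrMatrix (θ' t) n)⁻¹ * corrMatrix (θ t) n).trace) / n) hc0 hn fun t => by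
        rw [div_sub_one hn0.ne', abs_div, abs_of_pos hn0]
        gcongr
        exact (hc n t _ (Set.Ioo_subset_Icc_self (hθ t)) _ (Set.Ioo_subset_Icc_self (hθ' t))).1
    calc _ ≤ β₁ 0 ^ d * (d * c * Real.exp (d * c) / n) :=
          mul_le_mul hφd hp (abs_nonneg _) (by positivity)
      _ = C₁ / n := by rw [hC₁, ← mul_div_assoc]
      _ ≤ (C₁ + C₂) / n := by gcongr; linarith
  have hvar : ∀ n : ℕ, 1 ≤ n →
      variance (fun ω => quadForm θ' n (obs X n ω)) P ≤ (C₁ + C₂) / (n : ℝ) ^ d := by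
    intro n hn
    have hn1 : (1 : ℝ) ≤ n := by exact_mod_cast hn
    have hn0 : (0 : ℝ) < n := by linarith
    refine (hmom n).2.2.trans ?_
    have hnonneg : ∀ t, 0 ≤ ((θ' t ^ 3 / θ t ^ 3) ^ 2 * (((corrMatrix (θ' t) n)⁻¹ *
        corrMatrix (θ t) n) * ((corrMatrix (θ' t) n)⁻¹ * corrMatrix (θ t) n)).trace) /
        (n : ℝ) ^ 2 := fun t => by
      have := trace_mul_self_nonneg (corrMatrix_posDef (hθ'0 t) n).inv.posSemidef
        (corrMatrix_posDef (hθ0 t) n).isHermitian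
      positivity
    have hprod : ∏ t, ((θ' t ^ 3 / θ t ^ 3) ^ 2 * (((corrMatrix (θ' t) n)⁻¹ *
        corrMatrix (θ t) n) * ((corrMatrix (θ' t) n)⁻¹ * corrMatrix (θ t) n)).trace) /
        (n : ℝ) ^ 2 ≤ ∏ _t : Fin d, c * (1 + c) / n := by
      refine Finset.prod_le_prod (fun t _ => hnonneg t) fun t _ => ?_
      have h := (hc n t _ (Set.Ioo_subset_Icc_self (hθ t)) _
        (Set.Ioo_subset_Icc_self (hθ' t))).2
      rw [div_le_div_iff₀ (by positivity) hn0]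
      -- Since n ≥ 1, n + c ≤ (1 + c)n; division by n² leaves one factor 1/n per coordinate.
      have h' : c * (n + c) ≤ c * ((1 + c) * n) :=
        mul_le_mul_of_nonneg_left (by nlinarith) hc0
      calc _ ≤ c * ((1 + c) * n) * n := mul_le_mul_of_nonneg_right (h.trans h') hn0.le
        _ = _ := by ring
    calc _ ≤ fourthMoment * (β₁ 0 ^ d) ^ 2 * ∏ _t : Fin d, c * (1 + c) / n := by
          gcongr
          exact Finset.prod_nonneg fun t _ => hnonneg t
      _ = C₂ / (n : ℝ) ^ d := by
          rw [hC₂, Finset.prod_const, Finset.card_univ, Fintype.card_fin, div_pow, mul_div_assoc]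
      _ ≤ _ := by gcongr; linarith
  refine ⟨fun n => (hmom n).1, hmean, hvar, fun n hn => ?_, ?_⟩
  · filter_upwards [hX.ae_obs_ne_zero hθ0 hφ0 hn] with ω hω
    exact ⟨phiHat_pos hθ'0 hn hω, fun ψ hψ hne => likelihood_lt hd hθ'0 hn hω hψ hne⟩
  · have hQ : TendstoInMeasure P (fun n ω => quadForm θ' n (obs X n ω)) atTop
        fun _ => φ ^ d := by
      refine tendstoInMeasure_const_of_variance (fun n => (hmom n).1) ?_ ?_
      · rw [tendsto_iff_dist_tendsto_zero]
        refine squeeze_zero' (.of_forall fun _ => dist_nonneg) ?_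
          (tendsto_const_div_atTop_nhds_zero_nat (C₁ + C₂))
        filter_upwards [eventually_ge_atTop 1] with n hn
        exact hmean n hn
      · refine squeeze_zero' (.of_forall fun _ => variance_nonneg _ _) ?_
          (Tendsto.const_div_atTop ((tendsto_pow_atTop (by lia : d ≠ 0)).comp
            tendsto_natCast_atTop_atTop) (C₁ + C₂))
        filter_upwards [eventually_ge_atTop 1] with n hn
        exact hvar n hn
    have := TendstoInMeasure.comp_continuousAt hQ (g := fun y => y ^ (1 / (d : ℝ)))
      (Real.continuousAt_rpow_const _ _ (.inl (pow_pos hφ0 d).ne'))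
    simp only [one_div, Real.pow_rpow_inv_natCast hφ0.le (by lia : d ≠ 0)] at this
    simpa only [phiHat, one_div] using this
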